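/- Let $S$ be a finite set of primes (so $\infty\notin S$), let $d\ge 1$, $m\ge 0$ and $n=d+m$. For $k\ge1$ put $\mathbb{Z}_S^k=\prod_{\nu\in S}\mathbb{Z}_\nu^k$, and let $\mu_{S,d}$ be the Haar probability measure on $\mathbb{Z}_S^d$, i.e. the product of the Haar probability measures on the factors $\mathbb{Z}_\nu$. For every $\nu\in S$ let $\mathcal{U}_\nu\subseteq\mathbb{Z}_\nu^d$ be open and let $\mathbf{f}_\nu:\mathcal{U}_\nu\to\mathbb{Z}_\nu^m$ be $C^2$ in the sense of ultrametric calculus (it is continuous, and all difference quotients of orders $1$ and $2$ of its components extend continuously to all configurations of nodes in $\mathcal{U}_\nu$). Put $\mathcal{U}=\prod_{\nu\in S}\mathcal{U}_\nu$, $\mathbf{F}(\mathbf{x})=(\mathbf{x}_\nu,\mathbf{f}_\nu(\mathbf{x}_\nu))_{\nu\in S}\in\mathbb{Z}_S^n$ for $\mathbf{x}\in\mathcal{U}$, and $\mathcal{M}=\mathbf{F}(\mathcal{U})$. For $\tilde{\mathbf{b}}=(b_0,\dots,b_n)\in\mathbb{Z}^{n+1}$ let $\|\tilde{\mathbf{b}}\|_\infty=\max_i|b_i|$.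 For weights $\boldsymbol{\tau}=(\tau_{i,\nu})_{1\le i\le n,\,\nu\in S}$ with all $\tau_{i,\nu}>0$: * for $c>0$ let $W(c,\boldsymbol\tau)$ be the set of $\mathbf{y}\in\mathbb{Z}_S^n$ such that, for infinitely many $\tilde{\mathbf{b}}\in\mathbb{Z}^{n+1}$, $|b_0y_{i,\nu}-b_i|_\nu<c\,\|\tilde{\mathbf{b}}\|_\infty^{-\tau_{i,\nu}}$ for all $i$ and $\nu$; the set of $\boldsymbol\tau$-badly approximable points is $\mathbf{Bad}^{(S)}_n(\boldsymbol\tau)=\mathbb{Z}_S^n\setminus\bigcap_{\ell\ge1}W(1/\ell,\boldsymbol\tau)$; * for $\mathbf{y}\in\mathbb{Z}_S^n$ let $\omega_{\boldsymbol\tau}(\mathbf{y})\in[-\infty,\infty]$ be the supremum of the real $\omega$ for which $\max_{i,\nu}|b_0y_{i,\nu}+b_i|_\nu^{1/\tau_{i,\nu}}\le\|\tilde{\mathbf{b}}\|_\infty^{-\omega}$ for infinitely many $\tilde{\mathbf{b}}\in\mathbb{Z}^{n+1}$; * let $\omega_{\boldsymbol\tau}(\mathcal{M})$ be the infimum of the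 $\omega\in[-\infty,\infty]$ such that $\omega_{\boldsymbol\tau}(\mathbf{F}(\mathbf{x}))\le\omega$ for $\mu_{S,d}$-almost every $\mathbf{x}\in\mathcal{U}$. Let $\boldsymbol\tau$ be positive weights with $$\sum_{i=1}^n\sum_{\nu\in S}\tau_{i,\nu}=n+1,\qquad \min_{1\le i\le d}\tau_{i,\nu}\ge\max_{1\le j\le m}\tau_{d+j,\nu}\quad(\nu\in S),\qquad \sum_{\nu\in S}\tau_{i,\nu}>1\quad(1\le i\le n).$$ For $\nu\in S$ and $0<\alpha<\min\{1,\min_{i,\sigma}\tau_{i,\sigma}\}$ let $$\tau^{\nu,\alpha}_{i,\nu}=\frac{(\tau_{i,\nu}-\alpha)(n+1)}{n+1-n\alpha},\qquad \tau^{\nu,\alpha}_{i,\sigma}=\frac{\tau_{i,\sigma}(n+1)}{n+1-n\alpha}\quad(\sigma\in S\setminus\{\nu\}).$$ Suppose that for every $\nu\in S$ with $\min_{1\le i\le n}\tau_{i,\nu}\le1$ there is some $0<\alpha<\min_{i,\sigma}\tau_{i,\sigma}$ (necessarily $\alpha<1$) with $$\omega_{\boldsymbol\tau^{\nu,\alpha}}(\mathcal{M})<1+\frac{\alpha}{(1-\alpha)(n+1)}.$$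 Then $\mu_{S,d}\big(\mathbf{F}^{-1}(\mathbf{Bad}^{(S)}_n(\boldsymbol\tau))\big)=0$. -/

import Mathlib

open MeasureTheory

noncomputable section

namespace SArith

instance factPrime (p : Nat.Primes) : Fact (p : ℕ).Prime := ⟨p.2⟩

instance measurableSpacePadicInt (p : ℕ) [Fact p.Prime] : MeasurableSpace ℤ_[p] := borel _

instance borelSpacePadicInt (p : ℕ) [Fact p.Prime] : BorelSpace ℤ_[p] := ⟨rfl⟩

/-- `ℤ_S^n = ∏_{ν ∈ S} ℤ_ν^n` for a finite set `S` of primes. -/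
abbrev ZS (S : Finset Nat.Primes) (n : ℕ) : Type :=
  (ν : S) → Fin n → ℤ_[((ν : Nat.Primes) : ℕ)]

/-- The normalised Haar measure on `ℤ_S^n`: the product over `ν ∈ S` and over the `n` coordinates
of the Haar probability measures on `ℤ_ν`. -/
def haarS (S : Finset Nat.Primes) (n : ℕ) : Measure (ZS S n) :=
  Measure.pi fun _ => Measure.pi fun _ => Measure.addHaarMeasure ⊤

/-! ### Maps of class `C²` in ultrametric calculus

Over `ℚ_p`, being `C²` means that all difference quotients of order at most two extend
continuously to the points where increments vanish or coincide (iterated Fréchet derivatives give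
a much weaker notion). -/

section C2

variable {p : ℕ} [Fact p.Prime] {d m : ℕ}

/-- First order difference quotient of `f` in the `i`-th coordinate, with nodes
`x_i` and `x_i + h`. -/
def quot1 (f : (Fin d → ℤ_[p]) → ℤ_[p]) (i : Fin d) (x : Fin d → ℤ_[p]) (h : ℤ_[p]) : ℚ_[p] :=
  ((f (x + Pi.single i h) : ℚ_[p]) - f x) / h

/-- Second order difference quotient of `f` in the `i`-th coordinate, with nodes
`x_i`, `x_i + h`, `x_i + k`. -/
def quot2 (f : (Fin d → ℤ_[p]) → ℤ_[p]) (i : Fin d) (x : Fin d → ℤ_[p]) (h k : ℤ_[p]) : ℚ_[p] :=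
  (quot1 f i x h - quot1 f i x k) / ((h : ℚ_[p]) - k)

/-- Mixed second order difference quotient of `f` in the `i`-th and `j`-th coordinates. -/
def quotMixed (f : (Fin d → ℤ_[p]) → ℤ_[p]) (i j : Fin d) (x : Fin d → ℤ_[p])
    (h k : ℤ_[p]) : ℚ_[p] :=
  (quot1 f i (x + Pi.single j k) h - quot1 f i x h) / k

/-- The scalar function `f` is `C²` on `U`: it is continuous, and its difference quotients of
orders one and two extend continuously to all configurations of nodes in `U`. -/
def IsC2On (f : (Fin d → ℤ_[p]) → ℤ_[p]) (U : Set (Fin d → ℤ_[p])) : Prop :=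
  ContinuousOn f U ∧
  (∀ i, ∃ g : (Fin d → ℤ_[p]) × ℤ_[p] → ℚ_[p],
    ContinuousOn g {q | q.1 ∈ U ∧ q.1 + Pi.single i q.2 ∈ U} ∧
    ∀ x h, x ∈ U → x + Pi.single i h ∈ U → h ≠ 0 → g (x, h) = quot1 f i x h) ∧
  (∀ i, ∃ g : (Fin d → ℤ_[p]) × ℤ_[p] × ℤ_[p] → ℚ_[p],
    ContinuousOn g
      {q | q.1 ∈ U ∧ q.1 + Pi.single i q.2.1 ∈ U ∧ q.1 + Pi.single i q.2.2 ∈ U} ∧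
    ∀ x h k, x ∈ U → x + Pi.single i h ∈ U → x + Pi.single i k ∈ U →
      h ≠ 0 → k ≠ 0 → h ≠ k → g (x, h, k) = quot2 f i x h k) ∧
  (∀ i j, i ≠ j → ∃ g : (Fin d → ℤ_[p]) × ℤ_[p] × ℤ_[p] → ℚ_[p],
    ContinuousOn g
      {q | q.1 ∈ U ∧ q.1 + Pi.single i q.2.1 ∈ U ∧ q.1 + Pi.single j q.2.2 ∈ U ∧
        q.1 + Pi.single j q.2.2 + Pi.single i q.2.1 ∈ U} ∧
    ∀ x h k, x ∈ U → x + Pi.single i h ∈ U → x + Pi.single j k ∈ U →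
      x + Pi.single j k + Pi.single i h ∈ U →
      h ≠ 0 → k ≠ 0 → g (x, h, k) = quotMixed f i j x h k)

end C2

/-! ### Approximation -/

section Approximation

variable {S : Finset Nat.Primes} {n : ℕ}

/-- The `Ψ`-approximable points of `ℤ_S^n`: those `y` such that
`|b₀ y_{i,ν} - b_i|_ν < ψ_{i,ν}(b)` for all `i`, `ν` holds for infinitely many integer vectors
`b = (b₀, …, b_n)`. -/
def approximable (Ψ : Fin n → S → (Fin (n + 1) → ℤ) → ℝ) : Set (ZS S n) :=
  {y | {b : Fin (n + 1) → ℤ |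
    ∀ (i : Fin n) (ν : S), ‖(b 0 : ℤ_[((ν : Nat.Primes) : ℕ)]) * y ν i - b i.succ‖ < Ψ i ν b}.Infinite}

/-- The `τ`-badly approximable points of `ℤ_S^n`: those that fail to be
`ℓ⁻¹Ψ`-approximable for some `ℓ ≥ 1`, where `ψ_{i,ν}(b) = ‖b‖_∞^{-τ_{i,ν}}`.
(The norm of an integer vector is the maximum of the absolute values of its entries.)
This set contains the variant in which the points are moreover required to be
`Ψ`-approximable. -/
def Bad (τ : Fin n → S → ℝ) : Set (ZS S n) :=
  (⋂ ℓ : ℕ+, approximable fun i ν b => 1 / (ℓ : ℝ) * ‖b‖ ^ (-τ i ν))ᶜ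

/-- The weighted Diophantine exponent `ω_τ(y)` of a point. -/
def pointExponent (τ : Fin n → S → ℝ) (y : ZS S n) : EReal :=
  sSup ((fun ω : ℝ => (ω : EReal)) '' {ω : ℝ | {b : Fin (n + 1) → ℤ |
    ∀ (i : Fin n) (ν : S), ‖(b 0 : ℤ_[((ν : Nat.Primes) : ℕ)]) * y ν i + b i.succ‖ ^ (1 / τ i ν)
      ≤ 1 / ‖b‖ ^ ω}.Infinite})

/-- The weights `τ^{ν,α}`. -/
def modWeights (τ : Fin n → S → ℝ) (ν : S) (α : ℝ) : Fin n → S → ℝ := fun i σ =>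
  if σ = ν then (τ i σ - α) * (n + 1) / (n + 1 - n * α)
  else τ i σ * (n + 1) / (n + 1 - n * α)

end Approximation

/-! ### Manifolds -/

section Manifold

variable {S : Finset Nat.Primes} {d m : ℕ}

/-- The parametrisation `F(x) = (x_ν, f_ν(x_ν))_ν`. -/
def graphMap (f : (ν : S) → (Fin d → ℤ_[((ν : Nat.Primes) : ℕ)]) →
    Fin m → ℤ_[((ν : Nat.Primes) : ℕ)]) (x : ZS S d) : ZS S (d + m) :=
  fun ν => Fin.append (x ν) (f ν (x ν))

/-- The exponent `ω_τ(M)` of the manifold `M = F(U)`: the infimum of those `ω` with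
`ω_τ(F(x)) ≤ ω` for almost every `x ∈ U`. -/
def manifoldExponent (τ : Fin (d + m) → S → ℝ) (U : Set (ZS S d))
    (F : ZS S d → ZS S (d + m)) : EReal :=
  sInf {ω : EReal | ∀ᵐ x ∂haarS S d, x ∈ U → pointExponent τ (F x) ≤ ω}

end Manifold

end SArith

end

/-!
Dirichlet's theorem, applied to the linearisation of the system at `F(x)`, provides infinitely many
integer vectors `b` for which the errors in the first block of coordinates are at most a constant
`C` times `‖b‖ ^ (-τ)`, while those along the normal directions have an arbitrarily small constant.
A place whose weights all exceed `1` allows its prime to be divided out of `b`; at the other places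
the exponent hypothesis bounds the common divisor of the entries. In both cases `|b₀|_ν` is so
large that `(b_1/b_0, …, b_d/b_0)` is the centre of a small box around `x`. On the concentric box
that is smaller by a suitable fixed factor, `F` is close to its linearisation and all errors are
small, so no point of it is mapped to a point that avoids good approximations. By the strong density
theorem (for boxes of arbitrary eccentricity) this is impossible at almost every `x` for which
`F(x)` avoids them.
-/

noncomputable section

namespace SArith

open Filter Topology Set
open scoped ENNReal NNReal

/-! ### Strong density points in product spaces -/

/-- A differentiation basis: a decreasing sequence of countable families of measurable sets along
which almost every point of any measurable set `E` is a density point of `E`. -/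
structure IsDensityBasis {X : Type*} [MeasurableSpace X] (μ : Measure X)
    (𝓑 : ℕ → Set (Set X)) : Prop where
  antitone : Antitone 𝓑
  countable : ∀ k, (𝓑 k).Countable
  measurableSet : ∀ k, ∀ B ∈ 𝓑 k, MeasurableSet B
  ae_density : ∀ E, MeasurableSet E → ∀ c : ℝ≥0∞, c < 1 →
    ∀ᵐ x ∂μ, x ∈ E → ∃ k, ∀ B ∈ 𝓑 k, x ∈ B → c * μ B ≤ μ (E ∩ B)

theorem IsDensityBasis.ae_outer_density {X : Type*} [MeasurableSpace X] {μ : Measure X}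
    [IsFiniteMeasure μ] {𝓑 : ℕ → Set (Set X)} (h𝓑 : IsDensityBasis μ 𝓑) (E : Set X)
    {c : ℝ≥0∞} (hc : c < 1) :
    ∀ᵐ x ∂μ, x ∈ E → ∃ k, ∀ B ∈ 𝓑 k, x ∈ B → c * μ B ≤ μ (E ∩ B) := by
  filter_upwards [h𝓑.ae_density _ (measurableSet_toMeasurable μ E) c hc] with x hx hxE
  obtain ⟨k, hk⟩ := hx (subset_toMeasurable μ E hxE)
  refine ⟨k, fun B hB hxB => ?_⟩
  rw [← Measure.measure_toMeasurable_inter (h𝓑.measurableSet k B hB) (measure_ne_top μ E)]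
  exact hk B hB hxB

theorem exists_lt_one_le_pow {c : ℝ≥0∞} (hc : c < 1) (N : ℕ) : ∃ b < 1, c ≤ b ^ N := by
  have hlim : Tendsto (fun b : ℝ≥0∞ => b ^ N) (𝓝[<] 1) (𝓝 1) := by
    simpa using ((ENNReal.continuous_pow N).tendsto 1).mono_left nhdsWithin_le_nhds
  have : (𝓝[<] (1 : ℝ≥0∞)).NeBot := nhdsLT_neBot_of_exists_lt ⟨0, zero_lt_one⟩
  obtain ⟨b, hcb, hb⟩ := ((hlim.eventually (lt_mem_nhds hc)).and self_mem_nhdsWithin).exists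
  exact ⟨b, hb, hcb.le⟩

section Pi

variable {ι : Type*} {X : ι → Type*} [∀ i, MeasurableSpace (X i)] {μ : ∀ i, Measure (X i)}
  {𝓑 : ∀ i, ℕ → Set (Set (X i))} {E : Set (∀ i, X i)} {c : ℝ≥0∞}

theorem measurableSet_pi_sides (h𝓑 : ∀ i, IsDensityBasis (μ i) (𝓑 i)) {k : ℕ}
    {B : ∀ i, Set (X i)} (hB : B ∈ univ.pi fun i => 𝓑 i k) (t : Finset ι) :
    MeasurableSet ((t : Set ι).pi B) :=
  .pi t.countable_toSet fun i _ => (h𝓑 i).measurableSet k _ (hB i trivial)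

section Marginal

variable [DecidableEq ι]

theorem measurable_measure_update_preimage_inter [∀ i, SFinite (μ i)] (i : ι)
    (hE : MeasurableSet E) {B : Set (X i)} (hB : MeasurableSet B) :
    Measurable fun x => μ i (Function.update x i ⁻¹' E ∩ B) := by
  have hupdate : Measurable fun q : (∀ i, X i) × X i => Function.update q.1 i q.2 :=
    measurable_update'.comp measurable_id
  exact measurable_measure_prodMk_left ((hupdate hE).inter (measurable_snd hB))

/-- The points around which `E` has density at least `c ^ #t` in every box with sides in the
`k`-th families, when only the coordinates in `t` are integrated and the others are frozen. -/
def marginalDensitySet (μ : ∀ i, Measure (X i)) (𝓑 : ∀ i, ℕ → Set (Set (X i))) (c : ℝ≥0∞)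
    (E : Set (∀ i, X i)) (t : Finset ι) (k : ℕ) : Set (∀ i, X i) :=
  {x | ∀ B ∈ univ.pi fun i => 𝓑 i k, x ∈ (t : Set ι).pi B →
    c ^ t.card * ∏ i ∈ t, μ i (B i) ≤ (∫⋯∫⁻_t, (E ∩ (t : Set ι).pi B).indicator 1 ∂μ) x}

variable [∀ i, SigmaFinite (μ i)]

theorem le_lmarginal_insert_of_update_mem (h𝓑 : ∀ i, IsDensityBasis (μ i) (𝓑 i))
    (hE : MeasurableSet E) {t : Finset ι} {i : ι} (hi : i ∉ t) {k : ℕ} {B : ∀ i, Set (X i)}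
    (hB : B ∈ univ.pi fun i => 𝓑 i k) {x : ∀ i, X i} (hx : x ∈ (t : Set ι).pi B) {z : X i}
    (hz : z ∈ B i) (hxz : Function.update x i z ∈ marginalDensitySet μ 𝓑 c E t k) :
    c ^ t.card * ∏ j ∈ t, μ j (B j) ≤
      (∫⋯∫⁻_t, (E ∩ ((insert i t : Finset ι) : Set ι).pi B).indicator 1 ∂μ)
        (Function.update x i z) := by
  have hmeas (s : Finset ι) :
      Measurable ((E ∩ (s : Set ι).pi B).indicator (1 : (∀ i, X i) → ℝ≥0∞)) :=
    measurable_one.indicator (hE.inter (measurableSet_pi_sides h𝓑 hB s))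
  have hxzB : Function.update x i z ∈ (t : Set ι).pi B := fun j hj => by
    have hji : j ≠ i := fun h => hi (h ▸ hj)
    simpa [hji] using hx j hj
  refine (hxz B hB hxzB).trans ?_
  rw [lmarginal_update_of_notMem (hmeas _) hi, lmarginal_update_of_notMem (hmeas _) hi]
  refine lmarginal_mono (fun w => indicator_apply_le' (fun hw => ?_) fun _ => zero_le) x
  have hw' : Function.update w i z ∈ E ∩ ((insert i t : Finset ι) : Set ι).pi B := by
    rw [Finset.coe_insert, insert_pi]
    exact ⟨hw.1, by simpa using hz, hw.2⟩
  exact (indicator_of_mem hw' 1).ge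

theorem measurableSet_marginalDensitySet [Finite ι] (h𝓑 : ∀ i, IsDensityBasis (μ i) (𝓑 i))
    (hE : MeasurableSet E) (t : Finset ι) (k : ℕ) :
    MeasurableSet (marginalDensitySet μ 𝓑 c E t k) := by
  simp only [marginalDensitySet, ofPred_forall]
  refine .biInter (countable_univ_pi fun i => (h𝓑 i).countable k) fun B hB => ?_
  have hbox := measurableSet_pi_sides h𝓑 hB t
  rw [← compl_compl {x : ∀ i, X i | x ∈ (t : Set ι).pi B → _}]
  simp only [compl_ofPred, Classical.not_imp]
  exact (hbox.inter (measurableSet_le measurable_const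
    (.lmarginal μ (measurable_one.indicator (hE.inter hbox)))).compl).compl

theorem mem_marginalDensitySet_insert [Finite ι] (h𝓑 : ∀ i, IsDensityBasis (μ i) (𝓑 i))
    (hE : MeasurableSet E) {t : Finset ι} {i : ι} (hi : i ∉ t) {k l : ℕ} (hkl : k ≤ l)
    {x : ∀ i, X i} (hx : ∀ B ∈ 𝓑 i l, x i ∈ B → c * μ i B ≤
      μ i (Function.update x i ⁻¹' marginalDensitySet μ 𝓑 c E t k ∩ B)) :
    x ∈ marginalDensitySet μ 𝓑 c E (insert i t) l := by
  intro B hB hxB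
  have hBk : B ∈ univ.pi fun j => 𝓑 j k := fun j _ => (h𝓑 j).antitone hkl (hB j trivial)
  rw [Finset.coe_insert, insert_pi] at hxB
  set G := Function.update x i ⁻¹' marginalDensitySet μ 𝓑 c E t k ∩ B i
  have hG : MeasurableSet G :=
    (measurable_update x (measurableSet_marginalDensitySet h𝓑 hE t k)).inter
      ((h𝓑 i).measurableSet l _ (hB i trivial))
  rw [lmarginal_insert _
    (measurable_one.indicator (hE.inter (measurableSet_pi_sides h𝓑 hB _))) hi,
    Finset.card_insert_of_notMem hi, Finset.prod_insert hi]
  calc c ^ (t.card + 1) * (μ i (B i) * ∏ j ∈ t, μ j (B j))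
      = (c ^ t.card * ∏ j ∈ t, μ j (B j)) * (c * μ i (B i)) := by ring
    _ ≤ (c ^ t.card * ∏ j ∈ t, μ j (B j)) * μ i G := by
        gcongr
        exact hx (B i) (hB i trivial) hxB.1
    _ = ∫⁻ z, G.indicator (fun _ => c ^ t.card * ∏ j ∈ t, μ j (B j)) z ∂μ i := by
        rw [lintegral_indicator_const hG]
    _ ≤ _ := lintegral_mono fun z => indicator_apply_le' (fun hz =>
        le_lmarginal_insert_of_update_mem h𝓑 hE hi hBk hxB.2 hz.2 hz.1) fun _ => zero_le

variable [Fintype ι]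

theorem measure_pi_eq_zero_of_sections (i : ι) {A : Set (∀ i, X i)} (hA : MeasurableSet A)
    (h : ∀ x, μ i (Function.update x i ⁻¹' A) = 0) : Measure.pi μ A = 0 := by
  rcases isEmpty_or_nonempty (∀ i, X i) with h0 | ⟨⟨x⟩⟩
  · rw [eq_empty_of_isEmpty A, measure_empty]
  have hsection : (fun x => ∫⁻ z, A.indicator 1 (Function.update x i z) ∂μ i) = 0 := by
    funext x
    rw [Pi.zero_apply, ← h x, ← lintegral_indicator_one (measurable_update x hA)]
    rfl
  rw [← lintegral_indicator_one hA, lintegral_eq_lmarginal_univ x,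
    lmarginal_erase' _ (measurable_one.indicator hA) (Finset.mem_univ i), hsection]
  simp [lmarginal]

theorem ae_density_section (h𝓑 : ∀ i, IsDensityBasis (μ i) (𝓑 i)) (i : ι)
    (hE : MeasurableSet E) (hc : c < 1) :
    ∀ᵐ x ∂Measure.pi μ, x ∈ E → ∃ k, ∀ B ∈ 𝓑 i k, x i ∈ B →
      c * μ i B ≤ μ i (Function.update x i ⁻¹' E ∩ B) := by
  set D : Set (∀ i, X i) := {x | ∃ k, ∀ B ∈ 𝓑 i k, x i ∈ B →
    c * μ i B ≤ μ i (Function.update x i ⁻¹' E ∩ B)}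
  have hD : MeasurableSet D := by
    simp only [D, ofPred_exists, ofPred_forall]
    refine .iUnion fun k => .biInter ((h𝓑 i).countable k) fun B hB => ?_
    have hBm := (h𝓑 i).measurableSet k B hB
    rw [← compl_compl {x : ∀ i, X i | x i ∈ B → _}]
    simp only [compl_ofPred, Classical.not_imp]
    exact ((measurable_pi_apply i hBm).inter (measurableSet_le measurable_const
      (measurable_measure_update_preimage_inter i hE hBm)).compl).compl
  have hnull : Measure.pi μ (E \ D) = 0 :=
    measure_pi_eq_zero_of_sections i (hE.diff hD) fun x => by
      refine measure_mono_null ?_ (ae_iff.1 ((h𝓑 i).ae_density _ (measurable_update x hE) c hc))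
      rintro z ⟨hz, hzD⟩ hdens
      have hidem : Function.update (Function.update x i z) i = Function.update x i :=
        funext fun w => Function.update_idem ..
      exact hzD (by simpa [D, hidem] using hdens hz)
  filter_upwards [measure_eq_zero_iff_ae_notMem.1 hnull] with x hx hxE
  by_contra hxD
  exact hx ⟨hxE, hxD⟩

theorem ae_exists_mem_marginalDensitySet (h𝓑 : ∀ i, IsDensityBasis (μ i) (𝓑 i))
    (hE : MeasurableSet E) (hc : c < 1) (t : Finset ι) :
    ∀ᵐ x ∂Measure.pi μ, x ∈ E → ∃ k, x ∈ marginalDensitySet μ 𝓑 c E t k := by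
  induction t using Finset.induction with
  | empty => exact .of_forall fun x hx => ⟨0, fun B _ _ => by simp [hx]⟩
  | insert i t hi ih =>
    have hsection := ae_all_iff.2 fun k =>
      ae_density_section h𝓑 i (hE.inter (measurableSet_marginalDensitySet h𝓑 hE (c := c) t k)) hc
    filter_upwards [ih, hsection] with x hx hxs hxE
    obtain ⟨k, hk⟩ := hx hxE
    obtain ⟨l, hl⟩ := hxs k ⟨hxE, hk⟩
    refine ⟨max k l, mem_marginalDensitySet_insert h𝓑 hE hi (le_max_left k l) fun B hB hxB => ?_⟩
    refine (hl B ((h𝓑 i).antitone (le_max_right k l) hB) hxB).trans ?_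
    gcongr
    exact inter_subset_right

end Marginal

/-- The product boxes all of whose sides belong to the `k`-th of the given families; the sides may
shrink at independent rates. -/
def boxBasis (𝓑 : ∀ i, ℕ → Set (Set (X i))) (k : ℕ) : Set (Set (∀ i, X i)) :=
  univ.pi '' univ.pi fun i => 𝓑 i k

theorem IsDensityBasis.pi [Fintype ι] [∀ i, SigmaFinite (μ i)]
    (h𝓑 : ∀ i, IsDensityBasis (μ i) (𝓑 i)) :
    IsDensityBasis (Measure.pi μ) (boxBasis 𝓑) where
  antitone k l hkl := image_mono (pi_mono fun i _ => (h𝓑 i).antitone hkl)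
  countable k := (countable_univ_pi fun i => (h𝓑 i).countable k).image _
  measurableSet := by
    rintro k _ ⟨B, hB, rfl⟩
    exact .univ_pi fun i => (h𝓑 i).measurableSet k _ (hB i trivial)
  ae_density E hE c hc := by
    classical
    obtain ⟨b, hb, hcb⟩ := exists_lt_one_le_pow hc (Fintype.card ι)
    filter_upwards [ae_exists_mem_marginalDensitySet h𝓑 hE hb Finset.univ] with x hx hxE
    obtain ⟨k, hk⟩ := hx hxE
    refine ⟨k, ?_⟩
    rintro _ ⟨B, hB, rfl⟩ hxB
    have hdens := hk B hB (by simpa using hxB)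
    rw [Finset.coe_univ, lmarginal_univ, lintegral_indicator_one
      (hE.inter (.univ_pi fun i => (h𝓑 i).measurableSet k _ (hB i trivial)))] at hdens
    rw [Measure.pi_pi]
    exact (mul_le_mul_left hcb _).trans hdens

end Pi

/-- The closed balls of radius at most `1 / (k + 1)`. -/
def closedBallBasis (X : Type*) [PseudoMetricSpace X] (k : ℕ) : Set (Set X) :=
  {B | ∃ w r, 0 < r ∧ r ≤ 1 / ((k : ℝ) + 1) ∧ B = Metric.closedBall w r}

theorem isDensityBasis_closedBallBasis {X : Type*} [MetricSpace X] [IsUltrametricDist X]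
    [CompactSpace X] [MeasurableSpace X] [BorelSpace X] (μ : Measure X)
    [IsUnifLocDoublingMeasure μ] [IsLocallyFiniteMeasure μ] :
    IsDensityBasis μ (closedBallBasis X) where
  antitone k l hkl := by
    rintro B ⟨w, r, hr, hrl, rfl⟩
    exact ⟨w, r, hr, hrl.trans (Nat.one_div_le_one_div hkl), rfl⟩
  countable k := by
    have : Countable (TopologicalSpace.Clopens X) :=
      TopologicalSpace.Clopens.countable_iff_secondCountable.2 inferInstance
    refine (countable_range ((↑) : TopologicalSpace.Clopens X → Set X)).mono ?_
    rintro B ⟨w, r, hr, -, rfl⟩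
    exact ⟨⟨_, IsUltrametricDist.isClopen_closedBall w hr.ne'⟩, rfl⟩
  measurableSet := by
    rintro k B ⟨w, r, -, -, rfl⟩
    exact Metric.isClosed_closedBall.measurableSet
  ae_density E hE c hc := by
    have hlebesgue := IsUnifLocDoublingMeasure.ae_tendsto_measure_inter_div μ E 1
    rw [ae_restrict_iff' hE] at hlebesgue
    filter_upwards [hlebesgue] with x hx hxE
    have hlim := hx hxE (l := 𝓝[>] (0 : ℝ)) (fun _ => x) id tendsto_id <| by
      filter_upwards [self_mem_nhdsWithin] with r hr
      exact Metric.mem_closedBall_self (by simpa using le_of_lt hr)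
    obtain ⟨δ, hδ, hball⟩ := mem_nhdsGT_iff_exists_Ioo_subset.1 (hlim (lt_mem_nhds hc))
    obtain ⟨k, hk⟩ := exists_nat_one_div_lt (mem_Ioi.1 hδ)
    refine ⟨k, ?_⟩
    rintro B ⟨w, r, hr, hrk, rfl⟩ hxB
    rw [IsUltrametricDist.closedBall_eq_of_mem hxB]
    exact ENNReal.mul_le_of_le_div (hball ⟨hr, hrk.trans_lt hk⟩).le

section PadicBalls

variable {p : ℕ} [hp : Fact p.Prime]

theorem dvd_of_norm_le {a b : ℤ_[p]} (h : ‖a‖ ≤ ‖b‖) : b ∣ a := by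
  rcases eq_or_ne b 0 with rfl | hb
  · rw [norm_zero, norm_le_zero_iff] at h
    rw [h]
  have hquot : ‖(a : ℚ_[p]) / b‖ ≤ 1 := by
    rw [norm_div]
    exact div_le_one_of_le₀ h (norm_nonneg _)
  refine ⟨⟨_, hquot⟩, PadicInt.ext ?_⟩
  exact (mul_div_cancel₀ _ (PadicInt.coe_ne_zero.2 hb)).symm

theorem exists_closedBall_subset_biUnion (w : ℤ_[p]) (r : ℝ) :
    ∃ u : ℤ_[p], Metric.closedBall w r ⊆
      ⋃ a ∈ Finset.range p, Metric.closedBall (w + u * (a : ℤ_[p])) (r / p) := by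
  rcases lt_or_ge r 0 with hr | hr
  · exact ⟨0, by simp [Metric.closedBall_eq_empty.2 hr]⟩
  obtain ⟨u, hu, hmax⟩ := (isCompact_closedBall (0 : ℤ_[p]) r).exists_isMaxOn
    ⟨0, Metric.mem_closedBall_self hr⟩ continuous_norm.continuousOn
  refine ⟨u, fun x hx => ?_⟩
  have hxu : ‖x - w‖ ≤ ‖u‖ := hmax (by simpa [dist_eq_norm] using hx)
  obtain ⟨y, hy⟩ := dvd_of_norm_le hxu
  simp only [mem_iUnion, Finset.mem_range]
  refine ⟨y.appr 1, by simpa using PadicInt.appr_lt y 1, ?_⟩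
  have happr : ‖y - y.appr 1‖ ≤ (p : ℝ)⁻¹ := by
    simpa using (PadicInt.norm_le_pow_iff_mem_span_pow _ 1).2 (PadicInt.appr_spec 1 y)
  rw [mem_closedBall_iff_norm, ← sub_sub, hy, ← mul_sub, norm_mul, div_eq_mul_inv]
  gcongr
  simpa using hu

theorem haar_closedBall_le_mul (w w' : ℤ_[p]) (r : ℝ) :
    (Measure.addHaarMeasure ⊤ : Measure ℤ_[p]) (Metric.closedBall w r) ≤
      p * (Measure.addHaarMeasure ⊤ : Measure ℤ_[p]) (Metric.closedBall w' (r / p)) := by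
  set μ := (Measure.addHaarMeasure ⊤ : Measure ℤ_[p])
  have htranslate (z : ℤ_[p]) :
      μ (Metric.closedBall z (r / p)) = μ (Metric.closedBall w' (r / p)) := by
    rw [← measure_preimage_add μ (z - w') (Metric.closedBall z _), preimage_add_closedBall]
    simp
  obtain ⟨u, hu⟩ := exists_closedBall_subset_biUnion w r
  calc μ (Metric.closedBall w r)
      ≤ ∑ a ∈ Finset.range p, μ (Metric.closedBall (w + u * (a : ℤ_[p])) (r / p)) :=
        (measure_mono hu).trans (measure_biUnion_finset_le _ _)
    _ = p * μ (Metric.closedBall w' (r / p)) := by simp [htranslate]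

instance isUnifLocDoublingMeasure_haar :
    IsUnifLocDoublingMeasure (Measure.addHaarMeasure ⊤ : Measure ℤ_[p]) where
  exists_measure_closedBall_le_mul'' := by
    refine ⟨p, ?_⟩
    filter_upwards [self_mem_nhdsWithin] with r hr x
    have hp2 : (2 : ℝ) ≤ p := by exact_mod_cast hp.out.two_le
    have hp0 : (p : ℝ) ≠ 0 := by positivity
    calc _ ≤ (Measure.addHaarMeasure ⊤ : Measure ℤ_[p]) (Metric.closedBall x (p * r)) := by
          gcongr
          exact le_of_lt hr
      _ ≤ _ := by simpa [hp0] using haar_closedBall_le_mul x x (p * r)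

theorem exists_haar_closedBall_le_mul {θ : ℝ} (hθ : 0 < θ) : ∃ K : ℝ≥0∞, K ≠ ∞ ∧
    ∀ (w : ℤ_[p]) (r : ℝ), 0 ≤ r →
      (Measure.addHaarMeasure ⊤ : Measure ℤ_[p]) (Metric.closedBall w r) ≤
        K * (Measure.addHaarMeasure ⊤ : Measure ℤ_[p]) (Metric.closedBall w (θ * r)) := by
  set μ := (Measure.addHaarMeasure ⊤ : Measure ℤ_[p])
  have hp1 : (1 : ℝ) < p := by exact_mod_cast hp.out.one_lt
  obtain ⟨s, hs⟩ := exists_pow_lt_of_lt_one hθ (inv_lt_one_of_one_lt₀ hp1)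
  refine ⟨(p : ℝ≥0∞) ^ s, by simp, fun w r hr => ?_⟩
  have hiter (k : ℕ) : μ (Metric.closedBall w r) ≤
      p ^ k * μ (Metric.closedBall w ((p : ℝ)⁻¹ ^ k * r)) := by
    induction k with
    | zero => simp
    | succ k ih =>
      refine ih.trans ?_
      rw [pow_succ, mul_assoc, show (p : ℝ)⁻¹ ^ (k + 1) * r = (p : ℝ)⁻¹ ^ k * r / p by ring]
      gcongr
      exact haar_closedBall_le_mul _ _ _
  exact (hiter s).trans (by gcongr)

end PadicBalls

theorem inter_nonempty_of_density {X : Type*} [MeasurableSpace X] {μ : Measure X}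
    [IsFiniteMeasure μ] {E R R' : Set X} (hR' : MeasurableSet R') (hsub : R' ⊆ R) (hR : μ R ≠ 0)
    {K c : ℝ≥0∞} (hK : μ R ≤ K * μ R') (hc : 1 < c + K⁻¹) (hdens : c * μ R ≤ μ (E ∩ R)) :
    (E ∩ R').Nonempty := by
  by_contra! hempty
  have hK' : K⁻¹ * μ R ≤ μ R' := by
    rw [mul_comm, ← div_eq_mul_inv]
    exact ENNReal.div_le_of_le_mul' hK
  have hadd : (c + K⁻¹) * μ R ≤ 1 * μ R :=
    calc (c + K⁻¹) * μ R ≤ μ (E ∩ R) + μ R' := (add_mul _ _ _).trans_le (add_le_add hdens hK')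
      _ = μ (E ∩ R ∪ R') :=
        (measure_union ((disjoint_iff_inter_eq_empty.2 hempty).mono_left inter_subset_left)
          hR').symm
      _ ≤ 1 * μ R := (measure_mono (union_subset inter_subset_right hsub)).trans_eq (one_mul _).symm
  exact hc.not_ge ((ENNReal.mul_le_mul_iff_left hR (measure_ne_top _ _)).1 hadd)

section Boxes

variable {S : Finset Nat.Primes} {d : ℕ}

instance isFiniteMeasure_haarS : IsFiniteMeasure (haarS S d) := by
  unfold haarS; infer_instance

/-- The box in `ℤ_S^d` with centre `w` and prescribed radii in all coordinates. -/
def boxS (w : ZS S d) (r : S → Fin d → ℝ) : Set (ZS S d) :=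
  univ.pi fun ν => univ.pi fun i => Metric.closedBall (w ν i) (r ν i)

theorem mem_boxS {w x : ZS S d} {r : S → Fin d → ℝ} :
    x ∈ boxS w r ↔ ∀ ν i, ‖x ν i - w ν i‖ ≤ r ν i := by
  simp [boxS, dist_eq_norm]

theorem measurableSet_boxS (w : ZS S d) (r : S → Fin d → ℝ) : MeasurableSet (boxS w r) :=
  .univ_pi fun _ => .univ_pi fun _ => Metric.isClosed_closedBall.measurableSet

theorem haarS_boxS (w : ZS S d) (r : S → Fin d → ℝ) :
    haarS S d (boxS w r) = ∏ ν : S, ∏ i : Fin d,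
      (Measure.addHaarMeasure ⊤ : Measure ℤ_[((ν : Nat.Primes) : ℕ)])
        (Metric.closedBall (w ν i) (r ν i)) := by
  rw [haarS, boxS, Measure.pi_pi]
  exact Finset.prod_congr rfl fun ν _ => Measure.pi_pi _ _

theorem haarS_boxS_ne_zero (w : ZS S d) {r : S → Fin d → ℝ} (hr : ∀ ν i, 0 < r ν i) :
    haarS S d (boxS w r) ≠ 0 := by
  rw [haarS_boxS]
  exact Finset.prod_ne_zero_iff.2 fun ν _ => Finset.prod_ne_zero_iff.2
    fun i _ => (Metric.measure_closedBall_pos _ _ (hr ν i)).ne'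

theorem exists_haarS_boxS_le_mul {θ : S → ℝ} (hθ : ∀ ν, 0 < θ ν) : ∃ K : ℝ≥0∞, K ≠ ∞ ∧
    ∀ (w : ZS S d) (r : S → Fin d → ℝ), (∀ ν i, 0 ≤ r ν i) → haarS S d (boxS w r) ≤
      K * haarS S d (boxS w fun ν i => θ ν * r ν i) := by
  choose K hK hball using fun ν : S =>
    exists_haar_closedBall_le_mul (p := ((ν : Nat.Primes) : ℕ)) (hθ ν)
  refine ⟨∏ ν, ∏ _ : Fin d, K ν,
    ENNReal.prod_ne_top fun ν _ => ENNReal.prod_ne_top fun _ _ => hK ν, fun w r hr => ?_⟩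
  simp only [haarS_boxS, ← Finset.prod_mul_distrib]
  exact Finset.prod_le_prod' fun ν _ => Finset.prod_le_prod' fun i _ => hball ν _ _ (hr ν i)

theorem ae_haarS_boxS_density (E : Set (ZS S d)) : ∀ᵐ x ∂haarS S d, x ∈ E →
    ∀ c : ℝ≥0∞, c < 1 → ∃ δ : ℝ, 0 < δ ∧ ∀ (w : ZS S d) (r : S → Fin d → ℝ),
      (∀ ν i, 0 < r ν i ∧ r ν i ≤ δ) → x ∈ boxS w r →
        c * haarS S d (boxS w r) ≤ haarS S d (E ∩ boxS w r) := by
  have hbasis : IsDensityBasis (haarS S d) (boxBasis fun ν : S => boxBasis fun _ : Fin d =>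
      closedBallBasis ℤ_[((ν : Nat.Primes) : ℕ)]) :=
    .pi fun _ => .pi fun _ => isDensityBasis_closedBallBasis _
  obtain ⟨u, -, hu1, hu⟩ := exists_seq_strictMono_tendsto' (zero_lt_one' ℝ≥0∞)
  filter_upwards [ae_all_iff.2 fun n => hbasis.ae_outer_density E (hu1 n).2] with x hx hxE c hc
  obtain ⟨n, hn⟩ := (hu.eventually (lt_mem_nhds hc)).exists
  obtain ⟨k, hk⟩ := hx n hxE
  refine ⟨1 / ((k : ℝ) + 1), by positivity, fun w r hr hxw => ?_⟩
  refine (mul_le_mul_left hn.le _).trans (hk _ ?_ hxw)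
  exact ⟨_, fun ν _ => ⟨_, fun i _ => ⟨w ν i, r ν i, (hr ν i).1, (hr ν i).2, rfl⟩, rfl⟩, rfl⟩

-- If the smaller box, which fills a fixed proportion of the larger one, missed `E`, then `E` could
-- not have density close to one in the larger box.
theorem ae_inter_boxS_nonempty (E : Set (ZS S d)) : ∀ᵐ x ∂haarS S d, x ∈ E →
    ∀ θ : S → ℝ, (∀ ν, 0 < θ ν ∧ θ ν ≤ 1) → ∃ δ : ℝ, 0 < δ ∧ ∀ (w : ZS S d) (r : S → Fin d → ℝ),
      (∀ ν i, 0 < r ν i ∧ r ν i ≤ δ) → x ∈ boxS w r →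
        (E ∩ boxS w fun ν i => θ ν * r ν i).Nonempty := by
  filter_upwards [ae_haarS_boxS_density E] with x hx hxE θ hθ
  obtain ⟨K, hK, hbox⟩ := exists_haarS_boxS_le_mul (d := d) fun ν => (hθ ν).1
  obtain ⟨c, hc1, hc⟩ : ∃ c < 1, 1 < c + K⁻¹ := by
    obtain ⟨c, hc, hc1⟩ := exists_between
      (ENNReal.sub_lt_self ENNReal.one_ne_top one_ne_zero (ENNReal.inv_ne_zero.2 hK))
    refine ⟨c, hc1, lt_of_not_ge fun h => hc.not_ge (ENNReal.le_sub_of_add_le_right ?_ h)⟩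
    exact ne_top_of_le_ne_top ENNReal.one_ne_top (le_add_self.trans h)
  obtain ⟨δ, hδ, hdens⟩ := hx hxE c hc1
  refine ⟨δ, hδ, fun w r hr hxw => inter_nonempty_of_density (measurableSet_boxS _ _) ?_
    (haarS_boxS_ne_zero w fun ν i => (hr ν i).1) (hbox w r fun ν i => (hr ν i).1.le) hc
    (hdens w r hr hxw)⟩
  refine pi_mono fun ν _ => pi_mono fun i _ => Metric.closedBall_subset_closedBall ?_
  exact mul_le_of_le_one_left (hr ν i).1.le (hθ ν).2

end Boxes

/-! ### Integer solutions of systems of `p`-adic linear inequalities -/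

section Dirichlet

variable {ι : Type*}

/-- For every prime of `A`, the entries of `b` are not all divisible by that prime. -/
def IsPrimitiveAt (A : Set Nat.Primes) (b : ι → ℤ) : Prop :=
  ∀ p ∈ A, ∃ j, ‖(b j : ℤ_[(p : ℕ)])‖ = 1

theorem exists_primitive_part (A : Set Nat.Primes) {b : ι → ℤ} (hb : b ≠ 0) :
    ∃ (M : ℕ) (b' : ι → ℤ), b = M • b' ∧ (∀ p ∉ A, ‖(M : ℤ_[(p : ℕ)])‖ = 1) ∧
      IsPrimitiveAt A b' := by
  obtain ⟨i, hi⟩ := Function.ne_iff.1 hb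
  rw [Pi.zero_apply] at hi
  induction hN : (b i).natAbs using Nat.strong_induction_on generalizing b with
  | _ N ih =>
  by_cases hprim : IsPrimitiveAt A b
  · exact ⟨1, b, (one_smul _ b).symm, by simp, hprim⟩
  simp only [IsPrimitiveAt, not_forall, not_exists] at hprim
  obtain ⟨p, hpA, hp⟩ := hprim
  have hdvd : ∀ j, ∃ z, b j = (p : ℕ) * z := fun j =>
    PadicInt.norm_int_lt_one_iff_dvd (b j) |>.1 ((PadicInt.norm_le_one _).lt_of_ne (hp j))
  choose z hz using hdvd
  have hzi : z i ≠ 0 := fun h => hi (by rw [hz, h, mul_zero])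
  have hlt : (z i).natAbs < N := by
    rw [← hN, hz, Int.natAbs_mul, Int.natAbs_natCast]
    exact lt_mul_of_one_lt_left (Int.natAbs_pos.2 hzi) p.2.one_lt
  obtain ⟨M, b', rfl, hM, hb'⟩ := ih _ hlt (fun h => hzi (congrFun h i)) hzi rfl
  refine ⟨p * M, b', ?_, fun q hq => ?_, hb'⟩
  · funext j
    simp only [hz, Pi.smul_apply, nsmul_eq_mul, Nat.cast_mul, mul_assoc]
  · rw [Nat.cast_mul, norm_mul, hM q hq, mul_one, PadicInt.norm_natCast_eq_one_iff]
    exact (Nat.coprime_primes q.2 p.2).2 fun h => hq (Subtype.ext h ▸ hpA)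

variable [Fintype ι]

theorem exists_ne_zero_norm_le_of_card_lt {G : Type*} [AddCommGroup G] [Fintype G]
    (Φ : (ι → ℤ) →+ G) (Q : ℕ) (h : Fintype.card G < (Q + 1) ^ Fintype.card ι) :
    ∃ b ≠ 0, ‖b‖ ≤ Q ∧ Φ b = 0 := by
  classical
  obtain ⟨g, g', hne, heq⟩ := Fintype.exists_ne_map_eq_of_card_lt
    (fun g : ι → Fin (Q + 1) => Φ fun i => ((g i : ℕ) : ℤ)) (by simpa using h)
  refine ⟨(fun i => ((g i : ℕ) : ℤ)) - fun i => ((g' i : ℕ) : ℤ), fun h0 => hne ?_, ?_, ?_⟩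
  · funext i
    have := congrFun h0 i
    simp only [Pi.sub_apply, Pi.zero_apply] at this
    exact Fin.ext (by lia)
  · refine (pi_norm_le_iff_of_nonneg (Nat.cast_nonneg Q)).2 fun i => ?_
    have habs : |((g i : ℕ) : ℤ) - ((g' i : ℕ) : ℤ)| ≤ (Q : ℤ) := by grind
    rw [Pi.sub_apply, Int.norm_eq_abs]
    exact_mod_cast habs
  · rwa [map_sub, sub_eq_zero]

theorem one_le_norm_of_ne_zero {b : ι → ℤ} (hb : b ≠ 0) : 1 ≤ ‖b‖ := by
  obtain ⟨i, hi⟩ := Function.ne_iff.1 hb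
  refine le_trans ?_ (norm_le_pi_norm b i)
  rw [Int.norm_eq_abs]
  exact_mod_cast Int.one_le_abs hi

theorem inv_le_norm_natCast {p : ℕ} [hp : Fact p.Prime] {M : ℕ} (hM : M ≠ 0) :
    (M : ℝ)⁻¹ ≤ ‖(M : ℤ_[p])‖ := by
  have hM' : (M : ℤ_[p]) ≠ 0 := Nat.cast_ne_zero.2 hM
  have hdvd : p ^ (M : ℤ_[p]).valuation ∣ M := by
    rw [← Int.natCast_dvd_natCast, Nat.cast_pow, ← PadicInt.norm_int_le_pow_iff_dvd,
      Int.cast_natCast, PadicInt.norm_eq_zpow_neg_valuation hM']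
  rw [PadicInt.norm_eq_zpow_neg_valuation hM', zpow_neg, zpow_natCast]
  refine inv_anti₀ (pow_pos (Nat.cast_pos.2 hp.out.pos) _) ?_
  exact_mod_cast Nat.le_of_dvd (Nat.pos_of_ne_zero hM) hdvd

theorem mul_rpow_neg_le_rpow_neg {M N Q τ : ℝ} (hM : 1 ≤ M) (hN : 1 ≤ N) (h : M * N ≤ Q)
    (hτ : 1 ≤ τ) : M * Q ^ (-τ) ≤ N ^ (-τ) := by
  have hM0 : 0 < M := by linarith
  have hN0 : 0 < N := by linarith
  calc M * Q ^ (-τ) ≤ M * (M * N) ^ (-τ) := by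
        refine mul_le_mul_of_nonneg_left ?_ hM0.le
        exact Real.rpow_le_rpow_of_nonpos (by positivity) h (by linarith)
    _ = M ^ (1 + -τ) * N ^ (-τ) := by
        rw [Real.mul_rpow hM0.le hN0.le, Real.rpow_add hM0, Real.rpow_one, mul_assoc]
    _ ≤ N ^ (-τ) := mul_le_of_le_one_left (by positivity)
        (Real.rpow_le_one_of_one_le_of_nonpos hM (by linarith))

section Systems

variable {κ : Type*} [Fintype κ] {P : κ → Nat.Primes}

theorem exists_ne_zero_norm_le_zpow (L : ∀ k, (ι → ℤ) →+ ℤ_[(P k : ℕ)]) (e : κ → ℕ) (Q : ℕ)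
    (h : ∏ k, (P k : ℕ) ^ e k < (Q + 1) ^ Fintype.card ι) :
    ∃ b ≠ 0, ‖b‖ ≤ Q ∧ ∀ k, ‖L k b‖ ≤ (P k : ℝ) ^ (-e k : ℤ) := by
  classical
  have : ∀ k, NeZero ((P k : ℕ) ^ e k) := fun k => ⟨(pow_pos (P k).2.pos _).ne'⟩
  let Φ : (ι → ℤ) →+ ∀ k, ZMod ((P k : ℕ) ^ e k) :=
    AddMonoidHom.mk' (fun b k => PadicInt.toZModPow (e k) (L k b)) fun b b' => by
      funext k
      simp only [map_add, Pi.add_apply]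
  obtain ⟨b, hb, hbQ, hΦ⟩ := exists_ne_zero_norm_le_of_card_lt Φ Q (by
    simpa only [Fintype.card_pi, ZMod.card] using h)
  refine ⟨b, hb, hbQ, fun k => ?_⟩
  rw [PadicInt.norm_le_pow_iff_mem_span_pow, ← PadicInt.ker_toZModPow, RingHom.mem_ker]
  exact congrFun hΦ k

theorem exists_exponents_prod_pow_le {τ c : κ → ℝ} (hc : ∀ k, 0 < c k)
    (hprod : ∏ k, (P k : ℝ) ≤ ∏ k, c k) {Q : ℝ} (hQ0 : 0 < Q) (hQ : ∀ k, c k ≤ Q ^ τ k) :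
    ∃ e : κ → ℕ, ∏ k, (P k : ℝ) ^ e k ≤ Q ^ ∑ k, τ k ∧
      ∀ k, (P k : ℝ) ^ (-e k : ℤ) ≤ c k * Q ^ (-τ k) := by
  have hex : ∀ k, ∃ e : ℕ, (P k : ℝ) ^ e ≤ P k * (Q ^ τ k / c k) ∧
      Q ^ τ k / c k < (P k : ℝ) ^ e := by
    intro k
    obtain ⟨e, he, he'⟩ := exists_nat_pow_near ((one_le_div (hc k)).2 (hQ k))
      (Nat.one_lt_cast.2 (P k).2.one_lt)
    refine ⟨e + 1, ?_, he'⟩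
    rw [pow_succ']
    gcongr
  choose e he he' using hex
  refine ⟨e, ?_, fun k => ?_⟩
  · calc ∏ k, (P k : ℝ) ^ e k ≤ ∏ k, (P k * (Q ^ τ k / c k)) :=
          Finset.prod_le_prod (fun k _ => by positivity) fun k _ => he k
      _ = (∏ k, (P k : ℝ)) / (∏ k, c k) * Q ^ ∑ k, τ k := by
          rw [Finset.prod_mul_distrib, Finset.prod_div_distrib, Real.rpow_sum_of_pos hQ0]
          ring
      _ ≤ Q ^ ∑ k, τ k := mul_le_of_le_one_left (by positivity)
          ((div_le_one (Finset.prod_pos fun k _ => hc k)).2 hprod)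
  · rw [zpow_neg, zpow_natCast, Real.rpow_neg hQ0.le, ← div_eq_mul_inv, ← inv_div]
    exact inv_anti₀ (div_pos (Real.rpow_pos_of_pos hQ0 _) (hc k)) (he' k).le

variable [Nonempty ι] (L : ∀ k, (ι → ℤ) →+ ℤ_[(P k : ℕ)]) {τ c : κ → ℝ}
  (hτ : ∀ k, 0 < τ k) (hsum : ∑ k, τ k = Fintype.card ι)
  (hc : ∀ k, 0 < c k) (hprod : ∏ k, (P k : ℝ) ≤ ∏ k, c k)
include hτ hsum hc hprod

theorem eventually_exists_ne_zero_norm_le_rpow :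
    ∀ᶠ Q : ℕ in atTop, ∃ b ≠ 0, ‖b‖ ≤ Q ∧ ∀ k, ‖L k b‖ ≤ c k * (Q : ℝ) ^ (-τ k) := by
  have hlarge : ∀ᶠ Q : ℕ in atTop, ∀ k, c k ≤ (Q : ℝ) ^ τ k := eventually_all.2 fun k =>
    ((tendsto_rpow_atTop (hτ k)).comp tendsto_natCast_atTop_atTop).eventually_ge_atTop (c k)
  filter_upwards [hlarge, eventually_gt_atTop 0] with Q hQ hQ0
  obtain ⟨e, hcard, he⟩ := exists_exponents_prod_pow_le hc hprod (Nat.cast_pos.2 hQ0) hQ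
  rw [hsum, Real.rpow_natCast] at hcard
  have hcard' : ∏ k, (P k : ℕ) ^ e k < (Q + 1) ^ Fintype.card ι :=
    lt_of_le_of_lt (by exact_mod_cast hcard)
      (Nat.pow_lt_pow_left (Nat.lt_succ_self Q) Fintype.card_ne_zero)
  obtain ⟨b, hb, hbQ, hbL⟩ := exists_ne_zero_norm_le_zpow L e Q hcard'
  exact ⟨b, hb, hbQ, fun k => (hbL k).trans (he k)⟩

variable {A : Set Nat.Primes} (hτA : ∀ k, P k ∈ A → 1 < τ k)
include hτA

-- At a prime `p ∈ A`, dividing `b` by `M ≤ Q` costs at most a factor `M`, which `τ k > 1` absorbs.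
theorem eventually_exists_isPrimitiveAt :
    ∃ δ : κ → ℝ, (∀ k, 0 < δ k) ∧ ∀ᶠ Q : ℕ in atTop, ∃ b ≠ 0, IsPrimitiveAt A b ∧
      ∀ k, ‖L k b‖ ≤ c k * ‖b‖ ^ (-τ k) ∧ ‖L k b‖ ≤ c k * (Q : ℝ) ^ (-δ k) := by
  classical
  refine ⟨fun k => if P k ∈ A then τ k - 1 else τ k, fun k => ?_, ?_⟩
  · dsimp only
    split_ifs with hk
    exacts [sub_pos.2 (hτA k hk), hτ k]
  filter_upwards [eventually_exists_ne_zero_norm_le_rpow L hτ hsum hc hprod,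
    eventually_gt_atTop 0] with Q ⟨b, hb, hbQ, hbL⟩ hQ
  obtain ⟨M, b', rfl, hMA, hprim⟩ := exists_primitive_part A hb
  have hb' : b' ≠ 0 := right_ne_zero_of_smul hb
  have hM : M ≠ 0 := left_ne_zero_of_smul hb
  have hM1 : (1 : ℝ) ≤ M := Nat.one_le_cast.2 (Nat.one_le_iff_ne_zero.2 hM)
  have hb1 : 1 ≤ ‖b'‖ := one_le_norm_of_ne_zero hb'
  have hMQ : M * ‖b'‖ ≤ Q := by
    rwa [← Nat.cast_smul_eq_nsmul ℤ, norm_smul, Int.norm_natCast] at hbQ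
  have hQ0 : (0 : ℝ) < Q := Nat.cast_pos.2 hQ
  have hML : ∀ k, ‖(M : ℤ_[(P k : ℕ)])‖ * ‖L k b'‖ ≤ c k * (Q : ℝ) ^ (-τ k) := fun k => by
    rw [← norm_mul, ← nsmul_eq_mul, ← map_nsmul]
    exact hbL k
  refine ⟨b', hb', hprim, fun k => ?_⟩
  by_cases hk : P k ∈ A
  · have hL : ‖L k b'‖ ≤ c k * (M * (Q : ℝ) ^ (-τ k)) := by
      have := (mul_le_mul_of_nonneg_right (inv_le_norm_natCast hM) (norm_nonneg _)).trans (hML k)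
      rwa [inv_mul_le_iff₀ (by linarith), mul_left_comm] at this
    refine ⟨hL.trans ?_, hL.trans ?_⟩ <;> refine mul_le_mul_of_nonneg_left ?_ (hc k).le
    · exact mul_rpow_neg_le_rpow_neg hM1 hb1 hMQ (hτA k hk).le
    · rw [if_pos hk, neg_sub, sub_eq_add_neg, Real.rpow_add hQ0, Real.rpow_one]
      exact mul_le_mul_of_nonneg_right (by nlinarith) (by positivity)
  · have hL : ‖L k b'‖ ≤ c k * (Q : ℝ) ^ (-τ k) := by simpa only [hMA _ hk, one_mul] using hML k
    refine ⟨hL.trans (mul_le_mul_of_nonneg_left ?_ (hc k).le), by rwa [if_neg hk]⟩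
    exact Real.rpow_le_rpow_of_nonpos (by linarith) (by nlinarith) (by linarith [hτ k])

theorem exists_eq_zero_or_frequently_norm_le :
    (∃ b ≠ 0, ∀ k, L k b = 0) ∨
      ∃ᶠ b in cofinite, IsPrimitiveAt A b ∧ ∀ k, ‖L k b‖ ≤ c k * ‖b‖ ^ (-τ k) := by
  rw [or_iff_not_imp_right, frequently_cofinite_iff_infinite, not_infinite]
  intro hfin
  by_contra! hno
  obtain ⟨δ, hδ, hsol⟩ := eventually_exists_isPrimitiveAt L hτ hsum hc hprod hτA
  have hall : ∀ b ∈ {b | IsPrimitiveAt A b ∧ ∀ k, ‖L k b‖ ≤ c k * ‖b‖ ^ (-τ k)},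
      ∀ᶠ Q : ℕ in atTop, b ≠ 0 → ∃ k, c k * (Q : ℝ) ^ (-δ k) < ‖L k b‖ := by
    intro b _
    by_cases hb : b = 0
    · simp [hb]
    obtain ⟨k, hk⟩ := hno b hb
    have hlim : Tendsto (fun Q : ℕ => c k * (Q : ℝ) ^ (-δ k)) atTop (𝓝 0) := by
      simpa using ((tendsto_rpow_neg_atTop (hδ k)).comp
        tendsto_natCast_atTop_atTop).const_mul (c k)
    filter_upwards [hlim.eventually_lt_const (norm_pos_iff.2 hk)] with Q hQ _ using ⟨k, hQ⟩
  obtain ⟨Q, hQ, b, hb, hprim, hbL⟩ := ((hfin.eventually_all.2 hall).and hsol).exists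
  obtain ⟨k, hk⟩ := hQ b ⟨hprim, fun k => (hbL k).1⟩ hb
  exact hk.not_ge (hbL k).2

end Systems

end Dirichlet

section ErrorForm

variable {p : ℕ} [Fact p.Prime] {n : ℕ}

/-- The error `b₀y_i - b_i` of the rational point `(b_1/b_0, …, b_n/b_0)` as an approximation to
`y`, multiplied by its denominator `b₀`. -/
def errorForm (y : Fin n → ℤ_[p]) (i : Fin n) : (Fin (n + 1) → ℤ) →+ ℤ_[p] :=
  AddMonoidHom.mk' (fun b => b 0 * y i - b i.succ) fun b b' => by
    simp only [Pi.add_apply, Int.cast_add]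
    ring

theorem errorForm_apply (y : Fin n → ℤ_[p]) (i : Fin n) (b : Fin (n + 1) → ℤ) :
    errorForm y i b = b 0 * y i - b i.succ := rfl

end ErrorForm

/-! ### Bounds on the denominator coming from Diophantine exponents -/

section Exponent

variable {ι : Type*} [Fintype ι]

theorem tendsto_norm_cofinite : Tendsto (fun b : ι → ℤ => ‖b‖) cofinite atTop := by
  rw [← cocompact_eq_cofinite]
  exact tendsto_norm_cocompact_atTop

theorem exists_forall_of_eventually_cofinite {p : (ι → ℤ) → Prop} (h : ∀ᶠ b in cofinite, p b) :
    ∃ R : ℝ, ∀ b, R < ‖b‖ → p b := by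
  obtain ⟨R, hR⟩ := ((eventually_cofinite.1 h).image fun b => ‖b‖).bddAbove
  exact ⟨R, fun b hb => not_not.1 fun hp => hb.not_ge (hR (mem_image_of_mem _ hp))⟩

theorem exists_eq_pow_smul_of_norm_le_rpow {p : ℕ} [hp : Fact p.Prime] {α : ℝ} (hα : 0 ≤ α)
    {b : ι → ℤ} (hb : b ≠ 0) (h : ∀ j, ‖(b j : ℤ_[p])‖ ≤ ‖b‖ ^ (-α)) :
    ∃ (k : ℕ) (z : ι → ℤ), b = p ^ k • z ∧ (p : ℝ) ^ k ≤ ‖b‖ ^ α ∧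
      ‖b‖ ^ (1 - α) ≤ ‖z‖ ∧ ‖z‖ ≤ p * ‖b‖ ^ (1 - α) := by
  have hb1 : 1 ≤ ‖b‖ := one_le_norm_of_ne_zero hb
  have hb0 : 0 < ‖b‖ := by linarith
  obtain ⟨k, hk, hk'⟩ :=
    exists_nat_pow_near (Real.one_le_rpow hb1 hα) (Nat.one_lt_cast.2 hp.out.one_lt)
  have hpk : (0 : ℝ) < (p : ℝ) ^ k := pow_pos (Nat.cast_pos.2 hp.out.pos) _
  have hdvd : ∀ j, ∃ z, b j = (p ^ k : ℕ) * z := fun j => by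
    have hj : ‖(b j : ℤ_[p])‖ ≤ (p : ℝ) ^ (-k : ℤ) := by
      refine (h j).trans ?_
      rw [Real.rpow_neg hb0.le, zpow_neg, zpow_natCast]
      exact inv_anti₀ hpk hk
    exact_mod_cast PadicInt.norm_int_le_pow_iff_dvd.1 hj
  choose z hz using hdvd
  have hbz : b = p ^ k • z := by
    funext j
    rw [hz, Pi.smul_apply, nsmul_eq_mul]
  have hnorm : ‖b‖ = (p : ℝ) ^ k * ‖z‖ := by
    rw [hbz, ← Nat.cast_smul_eq_nsmul ℤ, norm_smul, Int.norm_natCast, Nat.cast_pow]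
  have hsplit : ‖b‖ ^ (1 - α) * ‖b‖ ^ α = (p : ℝ) ^ k * ‖z‖ := by
    rw [← Real.rpow_add hb0, sub_add_cancel, Real.rpow_one, ← hnorm]
  refine ⟨k, z, hbz, hk, ?_, ?_⟩
  · refine le_of_mul_le_mul_right ?_ hpk
    rw [mul_comm ‖z‖, ← hsplit]
    gcongr
  · refine le_of_mul_le_mul_left ?_ hpk
    calc (p : ℝ) ^ k * ‖z‖ = ‖b‖ ^ (1 - α) * ‖b‖ ^ α := hsplit.symm
      _ ≤ ‖b‖ ^ (1 - α) * (p : ℝ) ^ (k + 1) := by gcongr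
      _ = (p : ℝ) ^ k * (p * ‖b‖ ^ (1 - α)) := by ring

variable {S : Finset Nat.Primes} {n : ℕ} {τ : Fin n → S → ℝ} {y : ZS S n} {ν : S} {α : ℝ}

theorem mul_modWeights (hα : α < 1) (i : Fin n) (σ : S) :
    (1 - α) * ((1 + α / ((1 - α) * (n + 1))) * modWeights τ ν α i σ) =
      if σ = ν then τ i σ - α else τ i σ := by
  have h1α : 0 < 1 - α := sub_pos.2 hα
  have hD : (0 : ℝ) < n + 1 - n * α := by nlinarith [Nat.cast_nonneg (α := ℝ) n]
  have hω : (1 - α) * (1 + α / ((1 - α) * (n + 1))) = (n + 1 - n * α) / (n + 1) := by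
    field_simp
    ring
  rw [← mul_assoc, hω, modWeights]
  split_ifs <;> rw [div_mul_div_comm, div_eq_iff (by positivity)] <;> ring

theorem modWeights_pos (h0 : 0 < α) (h1 : α < 1) (hα : ∀ i σ, α < τ i σ) (i : Fin n) (σ : S) :
    0 < modWeights τ ν α i σ := by
  have hD : (0 : ℝ) < n + 1 - n * α := by nlinarith [Nat.cast_nonneg (α := ℝ) n]
  have hτ : 0 < τ i σ - α := sub_pos.2 (hα i σ)
  have hτ' : 0 < τ i σ := by linarith
  unfold modWeights
  split_ifs <;> positivity

theorem norm_errorForm_le_of_pow_smul {C : ℝ} {k : ℕ} {z : Fin (n + 1) → ℤ}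
    (hk : ((ν : Nat.Primes) : ℝ) ^ k ≤ ‖((ν : Nat.Primes) : ℕ) ^ k • z‖ ^ α)
    (hz : ((ν : Nat.Primes) : ℕ) ^ k • z ≠ 0) {i : Fin n} {σ : S}
    (h : ‖errorForm (y σ) i (((ν : Nat.Primes) : ℕ) ^ k • z)‖ ≤
      C * ‖((ν : Nat.Primes) : ℕ) ^ k • z‖ ^ (-τ i σ)) :
    ‖errorForm (y σ) i z‖ ≤
      C * ‖((ν : Nat.Primes) : ℕ) ^ k • z‖ ^ (-if σ = ν then τ i σ - α else τ i σ) := by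
  set b := ((ν : Nat.Primes) : ℕ) ^ k • z with hb
  have hfac : ‖errorForm (y σ) i b‖ =
      ‖(((ν : Nat.Primes) : ℕ) : ℤ_[((σ : Nat.Primes) : ℕ)])‖ ^ k * ‖errorForm (y σ) i z‖ := by
    rw [hb, map_nsmul, nsmul_eq_mul, norm_mul, Nat.cast_pow, norm_pow]
  rw [hfac] at h
  have hb0 : 0 < ‖b‖ := norm_pos_iff.2 hz
  split_ifs with hσ
  · subst hσ
    have hpk : (0 : ℝ) < ((σ : Nat.Primes) : ℝ) ^ k :=
      pow_pos (Nat.cast_pos.2 (σ : Nat.Primes).2.pos) _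
    rw [PadicInt.norm_p, inv_pow, inv_mul_le_iff₀ hpk] at h
    have hC : 0 ≤ C * ‖b‖ ^ (-τ i σ) := nonneg_of_mul_nonneg_right ((norm_nonneg _).trans h) hpk
    calc ‖errorForm (y σ) i z‖ ≤ ‖b‖ ^ α * (C * ‖b‖ ^ (-τ i σ)) :=
          h.trans (mul_le_mul_of_nonneg_right hk hC)
      _ = C * ‖b‖ ^ (-(τ i σ - α)) := by
          rw [neg_sub, sub_eq_add_neg, Real.rpow_add hb0]
          ring
  · have hne : Nat.Coprime (σ : Nat.Primes) (ν : Nat.Primes) :=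
      (Nat.coprime_primes σ.1.2 ν.1.2).2 fun h' => hσ (Subtype.ext (Subtype.ext h'))
    rwa [PadicInt.norm_natCast_eq_one_iff.2 hne, one_pow, one_mul] at h

/-- Changes the sign of `b₀`, to pass between the forms `b₀y_i + b_i` and `b₀y_i - b_i`. -/
def negHead (b : Fin (n + 1) → ℤ) : Fin (n + 1) → ℤ := Function.update b 0 (-b 0)

theorem norm_negHead (b : Fin (n + 1) → ℤ) : ‖negHead b‖ = ‖b‖ := by
  rw [Pi.norm_def, Pi.norm_def]
  congr 2
  funext j
  rcases eq_or_ne j 0 with rfl | hj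
  · rw [negHead, Function.update_self, nnnorm_neg]
  · rw [negHead, Function.update_of_ne hj]

theorem norm_negHead_add (y : ZS S n) (b : Fin (n + 1) → ℤ) (i : Fin n) (σ : S) :
    ‖((negHead b 0 : ℤ) : ℤ_[((σ : Nat.Primes) : ℕ)]) * y σ i + (negHead b i.succ : ℤ)‖ =
      ‖errorForm (y σ) i b‖ := by
  rw [negHead, Function.update_self, Function.update_of_ne (Fin.succ_ne_zero i), errorForm_apply,
    Int.cast_neg, ← norm_neg]
  congr 1
  ring

theorem injective_negHead : Function.Injective (negHead (n := n)) :=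
  Function.Involutive.injective fun b => by simp [negHead]

theorem eventually_exists_rpow_lt_norm_errorForm {ω : ℝ} (hτ : ∀ i σ, 0 < τ i σ)
    (hω : pointExponent τ y < ω) :
    ∀ᶠ b in cofinite, ∃ i σ, ‖b‖ ^ (-(ω * τ i σ)) < ‖errorForm (y σ) i b‖ := by
  have hfin : ∀ᶠ b : Fin (n + 1) → ℤ in cofinite, ¬ ∀ (i : Fin n) (σ : S),
      ‖(b 0 : ℤ_[((σ : Nat.Primes) : ℕ)]) * y σ i + b i.succ‖ ^ (1 / τ i σ) ≤ 1 / ‖b‖ ^ ω := by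
    rw [← not_frequently, frequently_cofinite_iff_infinite]
    exact fun hinf => hω.not_ge (le_sSup (mem_image_of_mem _ hinf))
  filter_upwards [injective_negHead.tendsto_cofinite.eventually hfin] with b hb
  by_contra! hle
  refine hb fun i σ => ?_
  rw [norm_negHead_add, norm_negHead, one_div, one_div, ← Real.rpow_neg (norm_nonneg b)]
  refine (Real.rpow_inv_le_iff_of_pos (norm_nonneg _) (by positivity) (hτ i σ)).2 ?_
  rw [← Real.rpow_mul (norm_nonneg b), neg_mul]
  exact hle i σ

/-- Every approximation `b` to `y` of quality `C‖b‖^{-τ}` has an entry whose `ν`-adic size is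
larger than `‖b‖^{-α}`, up to finitely many exceptions. -/
def HasLargeEntries (τ : Fin n → S → ℝ) (y : ZS S n) (ν : S) (α : ℝ) : Prop :=
  ∀ C : ℝ, ∀ᶠ b in cofinite, (∀ i σ, ‖errorForm (y σ) i b‖ ≤ C * ‖b‖ ^ (-τ i σ)) →
    ∃ j, ‖b‖ ^ (-α) < ‖(b j : ℤ_[((ν : Nat.Primes) : ℕ)])‖

theorem eventually_const_mul_rpow_le {C K a e : ℝ} (hK : 0 < K) (h : a < e) :
    ∀ᶠ t : ℝ in atTop, C * t ^ (-e) ≤ K * t ^ (-a) := by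
  have hlim : Tendsto (fun t : ℝ => C * t ^ (-(e - a))) atTop (𝓝 0) := by
    simpa using (tendsto_rpow_neg_atTop (sub_pos.2 h)).const_mul C
  filter_upwards [hlim.eventually_le_const hK, eventually_gt_atTop 0] with t ht ht0
  rw [show -e = -(e - a) + -a by ring, Real.rpow_add ht0, ← mul_assoc]
  exact mul_le_mul_of_nonneg_right ht (Real.rpow_nonneg ht0.le _)

theorem exists_real_between_pointExponent {ω : ℝ} (h0 : 0 < ω) (hω : pointExponent τ y < ω) :
    ∃ ω' : ℝ, 0 < ω' ∧ ω' < ω ∧ pointExponent τ y < ω' := by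
  obtain ⟨ω', hlt, hlt'⟩ :=
    EReal.lt_iff_exists_real_btwn.1 (max_lt hω (EReal.coe_lt_coe_iff.2 h0))
  rw [max_lt_iff, EReal.coe_lt_coe_iff] at hlt
  exact ⟨ω', hlt.2, EReal.coe_lt_coe_iff.1 hlt', hlt.1⟩

theorem eventually_mul_rpow_le_rpow_modWeights {C K ω : ℝ} (h0 : 0 < α) (h1 : α < 1)
    (hα : ∀ i σ, α < τ i σ) (hK : 0 < K) (hω : ω < 1 + α / ((1 - α) * (n + 1))) :
    ∀ᶠ t : ℝ in atTop, ∀ i σ, C * t ^ (-if σ = ν then τ i σ - α else τ i σ) ≤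
      (K * t ^ (1 - α)) ^ (-(ω * modWeights τ ν α i σ)) := by
  refine eventually_all.2 fun i => eventually_all.2 fun σ => ?_
  have hexp : (1 - α) * (ω * modWeights τ ν α i σ) < if σ = ν then τ i σ - α else τ i σ := by
    rw [← mul_modWeights h1 i σ]
    exact mul_lt_mul_of_pos_left (mul_lt_mul_of_pos_right hω (modWeights_pos h0 h1 hα i σ))
      (sub_pos.2 h1)
  filter_upwards [eventually_const_mul_rpow_le
      (Real.rpow_pos_of_pos hK (-(ω * modWeights τ ν α i σ))) hexp, eventually_ge_atTop 0]
    with t ht ht0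
  rwa [Real.mul_rpow hK.le (Real.rpow_nonneg ht0 _), ← Real.rpow_mul ht0, mul_neg]

-- If all entries of `b` are `ν`-adically smaller than `‖b‖^{-α}`, then `b` is divisible by a power
-- of `ν` close to `‖b‖^α`, and the quotient approximates `y` too well for the weights `τ^{ν,α}`.
theorem hasLargeEntries_of_pointExponent_lt (h0 : 0 < α) (h1 : α < 1) (hα : ∀ i σ, α < τ i σ)
    (hy : pointExponent (modWeights τ ν α) y < ((1 + α / ((1 - α) * (n + 1)) : ℝ) : EReal)) :
    HasLargeEntries τ y ν α := by
  intro C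
  have h1α : 0 < 1 - α := sub_pos.2 h1
  obtain ⟨ω, hω0, hω, hyω⟩ := exists_real_between_pointExponent (by positivity) hy
  have hw := modWeights_pos (ν := ν) h0 h1 hα
  have hp0 : (0 : ℝ) < (ν : Nat.Primes) := Nat.cast_pos.2 (ν : Nat.Primes).2.pos
  obtain ⟨R, hR⟩ := exists_forall_of_eventually_cofinite
    (eventually_exists_rpow_lt_norm_errorForm hw hyω)
  filter_upwards [tendsto_norm_cofinite.eventually
    ((eventually_mul_rpow_le_rpow_modWeights (ν := ν) (C := C) h0 h1 hα hp0 hω).and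
      ((tendsto_rpow_atTop h1α).eventually_gt_atTop R)), eventually_cofinite_ne 0]
    with b ⟨hb, hbR⟩ hb0 herr
  by_contra! hsmall
  obtain ⟨k, z, hbz, hk, hlow, hup⟩ := exists_eq_pow_smul_of_norm_le_rpow h0.le hb0 hsmall
  obtain ⟨i, σ, hiσ⟩ := hR z (hbR.trans_le hlow)
  refine hiσ.not_ge ?_
  have hz0 : 0 < ‖z‖ := norm_pos_iff.2 fun h => hb0 (by rw [hbz, h, smul_zero])
  have hneg : -(ω * modWeights τ ν α i σ) ≤ 0 := by linarith [mul_pos hω0 (hw i σ)]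
  calc ‖errorForm (y σ) i z‖ ≤ C * ‖b‖ ^ (-if σ = ν then τ i σ - α else τ i σ) := by
        rw [hbz] at hk hb0 herr ⊢
        exact norm_errorForm_le_of_pow_smul hk hb0 (herr i σ)
    _ ≤ (((ν : Nat.Primes) : ℝ) * ‖b‖ ^ (1 - α)) ^ (-(ω * modWeights τ ν α i σ)) := hb i σ
    _ ≤ ‖z‖ ^ (-(ω * modWeights τ ν α i σ)) := Real.rpow_le_rpow_of_nonpos hz0 hup hneg

end Exponent

/-! ### Differentiability -/

section Derivative

variable {p : ℕ} [Fact p.Prime] {ι : Type*} [Fintype ι] {f : (ι → ℤ_[p]) → ℤ_[p]}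
  {x : ι → ℤ_[p]}

/-- Differentiability of `f` at `x`, with partial derivatives in `ℚ_p`. It is spelled out because
`ℤ_p^ι` is not a normed space over `ℚ_p`, so that `HasFDerivAt` does not apply. -/
def IsDifferentiableAt (f : (ι → ℤ_[p]) → ℤ_[p]) (x : ι → ℤ_[p]) : Prop :=
  ∃ D : ι → ℚ_[p],
    (fun x' => ((f x' : ℚ_[p]) - f x) - ∑ i, D i * ((x' i : ℚ_[p]) - x i)) =o[𝓝 x]
      fun x' => x' - x

theorem IsDifferentiableAt.exists_integral_derivative (hf : IsDifferentiableAt f x) :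
    ∃ q : ℤ_[p], q ≠ 0 ∧ ∃ D : ι → ℤ_[p],
      (fun x' => q * (f x' - f x) - ∑ i, D i * (x' i - x i)) =o[𝓝 x] fun x' => x' - x := by
  obtain ⟨D, hD⟩ := hf
  obtain ⟨q, hq⟩ := IsLocalization.exist_integer_multiples_of_finite (nonZeroDivisors ℤ_[p]) D
  choose D' hD' using hq
  refine ⟨q, nonZeroDivisors.coe_ne_zero q, D', ?_⟩
  refine .of_norm_left ((hD.const_mul_left ((q : ℤ_[p]) : ℚ_[p])).norm_left.congr_left fun x' => ?_)
  have hD'' : ∀ i, ((D' i : ℤ_[p]) : ℚ_[p]) = ((q : ℤ_[p]) : ℚ_[p]) * D i := fun i =>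
    (hD' i).trans (Algebra.smul_def _ _)
  rw [PadicInt.norm_def]
  congr 1
  rw [PadicInt.coe_sub, PadicInt.coe_mul, PadicInt.coe_sub, PadicInt.coe_sum]
  simp only [PadicInt.coe_mul, PadicInt.coe_sub, hD'', mul_sub, Finset.mul_sum, mul_assoc]

end Derivative

section Staircase

variable {d : ℕ}

/-- The `k`-th point of the path from `x` to `x'` that changes one coordinate at a time. -/
def staircase {R : Type*} (x x' : Fin d → R) (k : ℕ) : Fin d → R := fun i =>
  if (i : ℕ) < k then x' i else x i

theorem staircase_succ {R : Type*} [AddCommGroup R] (x x' : Fin d → R) (i : Fin d) :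
    staircase x x' (i + 1) = staircase x x' i + Pi.single i (x' i - x i) := by
  funext j
  rcases lt_trichotomy j i with h | rfl | h
  · have hji : (j : ℕ) < i := h
    simp [staircase, hji.trans (Nat.lt_succ_self _), h.ne, h.not_ge]
  · simp [staircase]
  · have hji : ¬ (j : ℕ) < i + 1 := not_lt.2 h
    simp [staircase, hji, h.ne', h.not_gt]

theorem sub_eq_sum_staircase {R G : Type*} [AddCommGroup G] (F : (Fin d → R) → G)
    (x x' : Fin d → R) :
    F x' - F x = ∑ i : Fin d, (F (staircase x x' (i + 1)) - F (staircase x x' i)) := by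
  rw [← Finset.sum_range fun k => F (staircase x x' (k + 1)) - F (staircase x x' k),
    Finset.sum_range_sub fun k => F (staircase x x' k)]
  have hfirst : staircase x x' 0 = x := funext fun i => if_neg (Nat.not_lt_zero _)
  have hlast : staircase x x' d = x' := funext fun i => if_pos i.2
  rw [hfirst, hlast]

theorem tendsto_staircase {R : Type*} [TopologicalSpace R] (x : Fin d → R) (k : ℕ) :
    Tendsto (fun x' => staircase x x' k) (𝓝 x) (𝓝 x) := by
  refine tendsto_pi_nhds.2 fun i => ?_
  unfold staircase
  split_ifs
  exacts [(continuous_apply i).tendsto x, tendsto_const_nhds]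

variable {p : ℕ} [Fact p.Prime] {f : (Fin d → ℤ_[p]) → ℤ_[p]} {U : Set (Fin d → ℤ_[p])}
  {x : Fin d → ℤ_[p]}

theorem sub_eq_quot1_mul (i : Fin d) (z : Fin d → ℤ_[p]) {h : ℤ_[p]} (hh : h ≠ 0) :
    (f (z + Pi.single i h) : ℚ_[p]) - f z = quot1 f i z h * h :=
  (div_mul_cancel₀ _ (PadicInt.coe_ne_zero.2 hh)).symm

theorem IsC2On.exists_eventually_sub_eq_sum (hf : IsC2On f U) (hU : IsOpen U) (hx : x ∈ U) :
    ∃ (D : Fin d → ℚ_[p]) (G : Fin d → (Fin d → ℤ_[p]) → ℚ_[p]),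
      (∀ i, Tendsto (G i) (𝓝 x) (𝓝 (D i))) ∧
      ∀ᶠ x' in 𝓝 x, (f x' : ℚ_[p]) - f x = ∑ i, G i x' * ((x' i : ℚ_[p]) - x i) := by
  choose g hg hgq using hf.2.1
  have hinU : ∀ k, ∀ᶠ x' in 𝓝 x, staircase x x' k ∈ U := fun k =>
    (tendsto_staircase x k).eventually (hU.mem_nhds hx)
  have hstepU : ∀ i : Fin d, ∀ᶠ x' in 𝓝 x, staircase x x' i ∈ U ∧
      staircase x x' i + Pi.single i (x' i - x i) ∈ U := fun i => by
    filter_upwards [hinU i, hinU (i + 1)] with x' h h'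
    exact ⟨h, staircase_succ x x' i ▸ h'⟩
  refine ⟨fun i => g i (x, 0), fun i x' => g i (staircase x x' i, x' i - x i), fun i => ?_, ?_⟩
  · refine (hg i (x, 0) (by simpa using hx)).tendsto.comp
      (tendsto_nhdsWithin_iff.2 ⟨(tendsto_staircase x i).prodMk_nhds ?_, hstepU i⟩)
    exact tendsto_sub_nhds_zero_iff.2 ((continuous_apply i).tendsto x)
  · filter_upwards [eventually_all.2 hstepU] with x' hx'
    rw [sub_eq_sum_staircase (fun z => (f z : ℚ_[p])) x x']
    refine Finset.sum_congr rfl fun i _ => ?_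
    rw [staircase_succ, ← PadicInt.coe_sub (x' i) (x i)]
    rcases eq_or_ne (x' i - x i) 0 with h0 | h0
    · rw [h0]
      simp
    · rw [hgq i _ _ (hx' i).1 (hx' i).2 h0, sub_eq_quot1_mul i _ h0]

theorem IsC2On.isDifferentiableAt (hf : IsC2On f U) (hU : IsOpen U) (hx : x ∈ U) :
    IsDifferentiableAt f x := by
  obtain ⟨D, G, hlim, hsum⟩ := hf.exists_eventually_sub_eq_sum hU hx
  have hterm : ∀ i, (fun x' => (G i x' - D i) * ((x' i : ℚ_[p]) - x i)) =o[𝓝 x]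
      fun x' => x' - x := fun i => by
    have hcoord : (fun x' : Fin d → ℤ_[p] => (x' i : ℚ_[p]) - x i) =O[𝓝 x] fun x' => ‖x' - x‖ :=
      .of_norm_le fun x' => by
        rw [← PadicInt.coe_sub]
        exact norm_le_pi_norm (x' - x) i
    refine .of_norm_right ?_
    simpa using ((Asymptotics.isLittleO_one_iff ℝ).2
      (tendsto_sub_nhds_zero_iff.2 (hlim i))).mul_isBigO hcoord
  refine ⟨D, (Asymptotics.IsLittleO.sum (s := Finset.univ) fun i _ => hterm i).congr' ?_ .rfl⟩
  filter_upwards [hsum] with x' hx'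
  simp only [hx', ← Finset.sum_sub_distrib, sub_mul, Finset.sum_apply]

end Staircase

/-! ### The linearised system -/

section Tangent

variable {p : ℕ} [Fact p.Prime] {n d m : ℕ}

theorem lt_norm_head_of_norm_errorForm_le {y : Fin n → ℤ_[p]} {b : Fin (n + 1) → ℤ} {t : ℝ}
    (h : ∀ i, ‖errorForm y i b‖ ≤ t) {j : Fin (n + 1)} (hj : t < ‖(b j : ℤ_[p])‖) :
    t < ‖(b 0 : ℤ_[p])‖ := by
  induction j using Fin.cases with
  | zero => exact hj
  | succ i =>
    by_contra! h0
    refine hj.not_ge ?_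
    calc ‖(b i.succ : ℤ_[p])‖ = ‖(b 0 : ℤ_[p]) * y i - errorForm y i b‖ := by
          rw [errorForm_apply, sub_sub_cancel]
      _ ≤ max ‖(b 0 : ℤ_[p]) * y i‖ ‖errorForm y i b‖ := by
          rw [sub_eq_add_neg, ← norm_neg (errorForm y i b)]
          exact PadicInt.nonarchimedean _ _
      _ ≤ t := max_le ?_ (h i)
    rw [norm_mul]
    exact (mul_le_of_le_one_right (norm_nonneg _) (PadicInt.norm_le_one _)).trans h0

variable (y : Fin (d + m) → ℤ_[p]) (q : Fin m → ℤ_[p]) (D : Fin m → Fin d → ℤ_[p])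

/-- The linear forms whose smallness says that `(b_1/b_0, …, b_n/b_0)` is close to `y` in the
first `d` coordinates, and close to the tangent space `q_j y_{d+j}' = ∑ i, D_{j,i} y_i'` at `y` in
the others. -/
def tangentForm : Fin (d + m) → (Fin (d + m + 1) → ℤ) →+ ℤ_[p] :=
  Fin.append (fun i => errorForm y (Fin.castAdd m i)) fun j =>
    q j • errorForm y (Fin.natAdd d j) - ∑ i, D j i • errorForm y (Fin.castAdd m i)

theorem tangentForm_castAdd (i : Fin d) :
    tangentForm y q D (Fin.castAdd m i) = errorForm y (Fin.castAdd m i) :=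
  Fin.append_left _ _ _

theorem tangentForm_natAdd_apply (j : Fin m) (b : Fin (d + m + 1) → ℤ) :
    tangentForm y q D (Fin.natAdd d j) b = q j * errorForm y (Fin.natAdd d j) b -
      ∑ i, D j i * errorForm y (Fin.castAdd m i) b := by
  rw [tangentForm, Fin.append_right]
  simp only [AddMonoidHom.sub_apply, AddMonoidHom.smul_apply, AddMonoidHom.finsetSum_apply,
    smul_eq_mul]

variable {y q D}

theorem norm_mul_errorForm_natAdd_le {b : Fin (d + m + 1) → ℤ} {j : Fin m} {t : ℝ}
    (ht : ‖tangentForm y q D (Fin.natAdd d j) b‖ ≤ t)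
    (h : ∀ i, ‖errorForm y (Fin.castAdd m i) b‖ ≤ t) :
    ‖q j‖ * ‖errorForm y (Fin.natAdd d j) b‖ ≤ t := by
  have ht0 : 0 ≤ t := (norm_nonneg _).trans ht
  rw [← norm_mul, ← sub_add_cancel (q j * _) (∑ i, D j i * errorForm y (Fin.castAdd m i) b),
    ← tangentForm_natAdd_apply]
  refine (PadicInt.nonarchimedean _ _).trans (max_le ht ?_)
  refine IsUltrametricDist.norm_sum_le_of_forall_le_of_nonneg ht0 fun i _ => ?_
  rw [norm_mul]
  exact (mul_le_of_le_one_left (norm_nonneg _) (PadicInt.norm_le_one _)).trans (h i)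

theorem errorForm_eq_zero_of_tangentForm_eq_zero (hq : ∀ j, q j ≠ 0) {b : Fin (d + m + 1) → ℤ}
    (h : ∀ i, tangentForm y q D i b = 0) (i : Fin (d + m)) : errorForm y i b = 0 := by
  have hcast : ∀ i, errorForm y (Fin.castAdd m i) b = 0 := fun i =>
    tangentForm_castAdd y q D i ▸ h (Fin.castAdd m i)
  induction i using Fin.addCases with
  | left i => exact hcast i
  | right j =>
    have := norm_mul_errorForm_natAdd_le (t := 0) (h (Fin.natAdd d j) ▸ norm_zero.le)
      fun i => (hcast i ▸ norm_zero.le)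
    rw [← norm_mul, norm_le_zero_iff] at this
    exact (mul_eq_zero.1 this).resolve_left (hq j)

theorem exists_norm_errorForm_le (hq : ∀ j, q j ≠ 0) {t : Fin (d + m) → ℝ}
    (ht : ∀ i j, t (Fin.natAdd d j) ≤ t (Fin.castAdd m i)) {C η : ℝ} (hC : 0 ≤ C) :
    ∃ C', ∀ b ≠ 0, (∀ i, ‖tangentForm y q D i b‖ ≤
      Fin.append (fun _ => C) (fun _ => η) i * ‖b‖ ^ (-t i)) →
        ∀ i, ‖errorForm y i b‖ ≤ C' * ‖b‖ ^ (-t i) := by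
  obtain ⟨K, hK⟩ := Finite.exists_le fun j => ‖q j‖⁻¹
  refine ⟨max K 1 * max C η, fun b hb h => ?_⟩
  have hb1 : 1 ≤ ‖b‖ := one_le_norm_of_ne_zero hb
  have hcast : ∀ i, ‖errorForm y (Fin.castAdd m i) b‖ ≤ C * ‖b‖ ^ (-t (Fin.castAdd m i)) :=
    fun i => by simpa only [tangentForm_castAdd, Fin.append_left] using h (Fin.castAdd m i)
  intro i
  induction i using Fin.addCases with
  | left i =>
    refine (hcast i).trans ?_
    gcongr
    exact (le_max_left C η).trans (le_mul_of_one_le_left (by positivity) (le_max_right K 1))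
  | right j =>
    have hqpos : 0 < ‖q j‖ := norm_pos_iff.2 (hq j)
    have hmul : ‖q j‖ * ‖errorForm y (Fin.natAdd d j) b‖ ≤
        max C η * ‖b‖ ^ (-t (Fin.natAdd d j)) := by
      refine norm_mul_errorForm_natAdd_le (D := D) ((h (Fin.natAdd d j)).trans ?_)
        fun i => (hcast i).trans ?_
      · rw [Fin.append_right]
        gcongr
        exact le_max_right C η
      · gcongr
        exacts [le_max_left C η, ht i j]
    calc ‖errorForm y (Fin.natAdd d j) b‖ = ‖q j‖⁻¹ * (‖q j‖ * ‖errorForm y (Fin.natAdd d j) b‖) :=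
          (inv_mul_cancel_left₀ hqpos.ne' _).symm
      _ ≤ max K 1 * (max C η * ‖b‖ ^ (-t (Fin.natAdd d j))) := by
          gcongr
          exact (hK j).trans (le_max_left K 1)
      _ = _ := (mul_assoc _ _ _).symm

end Tangent

section LargeDenominators

variable {S : Finset Nat.Primes} {d m : ℕ}

/-- The primes at which all weights exceed `1`. -/
def largeWeightPrimes {n : ℕ} (τ : Fin n → S → ℝ) : Set Nat.Primes :=
  {p | ∃ h : p ∈ S, ∀ i, 1 < τ i ⟨p, h⟩}

theorem exists_const_prod_append_ge (hS : S.Nonempty) (hd : 0 < d) {η : ℝ} (hη : 0 < η) (B : ℝ) :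
    ∃ C : ℝ, 0 < C ∧
      B ≤ ∏ k : Fin (d + m) × S, (Fin.append (fun _ : Fin d => C) fun _ : Fin m => η) k.1 := by
  have hE : 0 < (η ^ S.card) ^ m := by positivity
  refine ⟨max 1 (B / (η ^ S.card) ^ m), by positivity, ?_⟩
  set C := max 1 (B / (η ^ S.card) ^ m)
  have hC1 : 1 ≤ C := le_max_left _ _
  have hCS : (C ^ S.card) ^ d = C ^ (S.card * d) := (pow_mul _ _ _).symm
  rw [Fintype.prod_prod_type, Fin.prod_univ_add]
  simp only [Fin.append_left, Fin.append_right, Finset.prod_const, Finset.card_univ,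
    Fintype.card_coe, Fintype.card_fin]
  calc B ≤ C * (η ^ S.card) ^ m := (div_le_iff₀ hE).1 (le_max_right _ _)
    _ ≤ (C ^ S.card) ^ d * (η ^ S.card) ^ m := by
        rw [hCS]
        gcongr
        exact le_self_pow₀ hC1 (mul_pos hS.card_pos hd).ne'

variable {τ : Fin (d + m) → S → ℝ} {y : ZS S (d + m)}
  {q : ∀ ν : S, Fin m → ℤ_[((ν : Nat.Primes) : ℕ)]}
  {D : ∀ ν : S, Fin m → Fin d → ℤ_[((ν : Nat.Primes) : ℕ)]} {α : S → ℝ}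

theorem eventually_lt_norm_entry {n : ℕ} {τ : Fin n → S → ℝ} {y : ZS S n} {ν : S} {α : ℝ}
    (hα : 0 < α) (hden : (∀ i, 1 < τ i ν) ∨ HasLargeEntries τ y ν α) (C : ℝ) :
    ∀ᶠ b in cofinite, (∀ i σ, ‖errorForm (y σ) i b‖ ≤ C * ‖b‖ ^ (-τ i σ)) →
      IsPrimitiveAt (largeWeightPrimes τ) b →
        ∃ j, ‖b‖ ^ (-α) < ‖(b j : ℤ_[((ν : Nat.Primes) : ℕ)])‖ := by
  rcases hden with hlarge | hentries
  · filter_upwards [tendsto_norm_cofinite.eventually_gt_atTop 1] with b hb _ hprim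
    obtain ⟨j, hj⟩ := hprim ν ⟨ν.2, hlarge⟩
    exact ⟨j, hj ▸ Real.rpow_lt_one_of_one_lt_of_neg hb (neg_lt_zero.2 hα)⟩
  · filter_upwards [hentries C] with b hb herr _ using hb herr

theorem eventually_lt_norm_head (hτdom : ∀ ν (i : Fin d) (j : Fin m),
      τ (Fin.natAdd d j) ν ≤ τ (Fin.castAdd m i) ν) (hq : ∀ ν j, q ν j ≠ 0) (hα0 : ∀ ν, 0 < α ν)
    (hα : ∀ i ν, α ν < τ i ν) (hden : ∀ ν, (∀ i, 1 < τ i ν) ∨ HasLargeEntries τ y ν (α ν))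
    {C η : ℝ} (hC : 0 ≤ C) :
    ∀ᶠ b in cofinite, (∀ ν i, ‖tangentForm (y ν) (q ν) (D ν) i b‖ ≤
        Fin.append (fun _ => C) (fun _ => η) i * ‖b‖ ^ (-τ i ν)) →
      IsPrimitiveAt (largeWeightPrimes τ) b →
        ∀ ν, ‖b‖ ^ (-α ν) < ‖(b 0 : ℤ_[((ν : Nat.Primes) : ℕ)])‖ := by
  choose C' hC' using fun ν =>
    exists_norm_errorForm_le (y := y ν) (D := D ν) (hq ν) (t := fun i => τ i ν) (hτdom ν)
      (η := η) hC
  obtain ⟨K, hK⟩ := Finite.exists_le C'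
  have hsmall : ∀ᶠ t : ℝ in atTop, ∀ i ν, K * t ^ (-τ i ν) ≤ 1 * t ^ (-α ν) :=
    eventually_all.2 fun i => eventually_all.2 fun ν =>
      eventually_const_mul_rpow_le one_pos (hα i ν)
  filter_upwards [eventually_all.2 fun ν => eventually_lt_norm_entry (hα0 ν) (hden ν) K,
    tendsto_norm_cofinite.eventually hsmall, eventually_cofinite_ne 0]
    with b hentry hb hb0 htan hprim ν
  have herr : ∀ i σ, ‖errorForm (y σ) i b‖ ≤ K * ‖b‖ ^ (-τ i σ) := fun i σ =>
    (hC' σ b hb0 (htan σ) i).trans (by gcongr; exact hK σ)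
  obtain ⟨j, hj⟩ := hentry ν herr hprim
  exact lt_norm_head_of_norm_errorForm_le
    (fun i => (herr i ν).trans ((hb i ν).trans_eq (one_mul _))) hj

theorem exists_errorForm_eq_zero_or_frequently (hd : 0 < d)
    (hτsum : ∑ i, ∑ ν, τ i ν = ((d + m : ℕ) : ℝ) + 1)
    (hτdom : ∀ ν (i : Fin d) (j : Fin m), τ (Fin.natAdd d j) ν ≤ τ (Fin.castAdd m i) ν)
    (hq : ∀ ν j, q ν j ≠ 0) (hα0 : ∀ ν, 0 < α ν) (hα : ∀ i ν, α ν < τ i ν)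
    (hden : ∀ ν, (∀ i, 1 < τ i ν) ∨ HasLargeEntries τ y ν (α ν)) {η : ℝ} (hη : 0 < η) :
    (∃ b ≠ 0, ∀ ν i, errorForm (y ν) i b = 0) ∨
    ∃ C > 0, ∃ᶠ b in cofinite, (∀ ν i, ‖tangentForm (y ν) (q ν) (D ν) i b‖ ≤
        Fin.append (fun _ => C) (fun _ => η) i * ‖b‖ ^ (-τ i ν)) ∧
      ∀ ν, ‖b‖ ^ (-α ν) < ‖(b 0 : ℤ_[((ν : Nat.Primes) : ℕ)])‖ := by
  have hS : S.Nonempty := by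
    rw [Finset.nonempty_iff_ne_empty]
    rintro rfl
    simp only [Finset.univ_eq_empty, Finset.sum_empty, Finset.sum_const_zero] at hτsum
    exact absurd hτsum (by positivity)
  obtain ⟨C, hC, hprod⟩ := exists_const_prod_append_ge (d := d) (m := m) hS hd hη
    (∏ k : Fin (d + m) × S, ((k.2 : Nat.Primes) : ℝ))
  have hcpos : ∀ k : Fin (d + m) × S,
      0 < (Fin.append (fun _ : Fin d => C) fun _ : Fin m => η) k.1 := fun k => by
    induction k.1 using Fin.addCases <;> simpa only [Fin.append_left, Fin.append_right]
  rcases exists_eq_zero_or_frequently_norm_le (P := fun k : Fin (d + m) × S => k.2)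
    (fun k => tangentForm (y k.2) (q k.2) (D k.2) k.1) (τ := fun k => τ k.1 k.2)
    (A := largeWeightPrimes τ) (fun k => (hα0 k.2).trans (hα k.1 k.2))
    (by rw [Fintype.sum_prod_type, hτsum, Fintype.card_fin, Nat.cast_succ]) hcpos hprod
    (fun k ⟨_, hk⟩ => hk k.1) with ⟨b, hb, hzero⟩ | hfreq
  · exact .inl ⟨b, hb, fun ν => errorForm_eq_zero_of_tangentForm_eq_zero (D := D ν) (hq ν)
      fun i => hzero (i, ν)⟩
  · refine .inr ⟨C, hC, (hfreq.and_eventually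
      (eventually_lt_norm_head hτdom hq hα0 hα hden (D := D) (η := η) hC.le)).mono ?_⟩
    rintro b ⟨⟨hprim, htan⟩, hhead⟩
    exact ⟨fun ν i => htan (i, ν), hhead (fun ν i => htan (i, ν)) hprim⟩

end LargeDenominators

/-! ### Points near a solution of the linearised system -/

section Center

variable {p : ℕ} [Fact p.Prime] {n d m : ℕ}

theorem ne_zero_of_cast_ne_zero {b : Fin n → ℤ} {j : Fin n} (h : (b j : ℤ_[p]) ≠ 0) : b ≠ 0 := by
  rintro rfl
  exact h Int.cast_zero

/-- The `i`-th radius of the box of those `y` for which the rational point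
`(b_1/b_0, …, b_n/b_0)` satisfies `|b_0 y_i - b_i|_p ≤ C ‖b‖ ^ (-τ_i)`. -/
def approxRadius (p : ℕ) [Fact p.Prime] (C : ℝ) (τ : Fin n → ℝ) (b : Fin (n + 1) → ℤ)
    (i : Fin n) : ℝ :=
  C * ‖b‖ ^ (-τ i) / ‖(b 0 : ℤ_[p])‖

theorem approxRadius_pos {C : ℝ} (hC : 0 < C) (τ : Fin n → ℝ) {b : Fin (n + 1) → ℤ}
    (hb0 : (b 0 : ℤ_[p]) ≠ 0) (i : Fin n) : 0 < approxRadius p C τ b i :=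
  div_pos (mul_pos hC (Real.rpow_pos_of_pos (norm_pos_iff.2 (ne_zero_of_cast_ne_zero hb0)) _))
    (norm_pos_iff.2 hb0)

theorem eventually_approxRadius_le {τ : Fin n → ℝ} {α : ℝ} (hα : ∀ i, α < τ i) (C : ℝ) {δ : ℝ}
    (hδ : 0 < δ) :
    ∀ᶠ b in cofinite, ‖b‖ ^ (-α) < ‖(b 0 : ℤ_[p])‖ → ∀ i, approxRadius p C τ b i ≤ δ := by
  have hev : ∀ᶠ t : ℝ in atTop, ∀ i, C * t ^ (-τ i) ≤ δ * t ^ (-α) :=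
    eventually_all.2 fun i => eventually_const_mul_rpow_le hδ (hα i)
  filter_upwards [tendsto_norm_cofinite.eventually hev] with b hb hhead i
  have hb0 : 0 < ‖(b 0 : ℤ_[p])‖ := (Real.rpow_nonneg (norm_nonneg b) _).trans_lt hhead
  exact (div_le_iff₀ hb0).2 ((hb i).trans (by gcongr))

theorem norm_mul_approxRadius (C : ℝ) (τ : Fin n → ℝ) {b : Fin (n + 1) → ℤ}
    (hb0 : (b 0 : ℤ_[p]) ≠ 0) (i : Fin n) :
    ‖(b 0 : ℤ_[p])‖ * approxRadius p C τ b i = C * ‖b‖ ^ (-τ i) :=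
  mul_div_cancel₀ _ (norm_ne_zero_iff.2 hb0)

variable {b : Fin (n + 1) → ℤ}

theorem errorForm_eq_head_mul {i : Fin n} {w : ℤ_[p]} (hw : (b i.succ : ℤ_[p]) = b 0 * w)
    (y : Fin n → ℤ_[p]) : errorForm y i b = b 0 * (y i - w) := by
  rw [errorForm_apply, hw, mul_sub]

theorem exists_center {C : ℝ} {τ : Fin n → ℝ} {y : Fin n → ℤ_[p]} {i : Fin n}
    (hb0 : (b 0 : ℤ_[p]) ≠ 0) (hr : approxRadius p C τ b i ≤ 1)
    (h : ‖errorForm y i b‖ ≤ C * ‖b‖ ^ (-τ i)) :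
    ∃ w : ℤ_[p], (b i.succ : ℤ_[p]) = b 0 * w ∧ ‖y i - w‖ ≤ approxRadius p C τ b i := by
  have hpos : 0 < ‖(b 0 : ℤ_[p])‖ := norm_pos_iff.2 hb0
  have hdvd : (b 0 : ℤ_[p]) ∣ errorForm y i b :=
    dvd_of_norm_le (h.trans ((div_le_one hpos).1 hr))
  obtain ⟨w, hw⟩ := (dvd_sub_right (dvd_mul_right _ _)).1 hdvd
  refine ⟨w, hw, (le_div_iff₀' hpos).2 ?_⟩
  rwa [← norm_mul, ← errorForm_eq_head_mul hw]

end Center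

section Graph

variable {p : ℕ} [Fact p.Prime] {d m : ℕ} {b : Fin (d + m + 1) → ℤ} {x x' : Fin d → ℤ_[p]}
  {v v' : Fin m → ℤ_[p]} {q : Fin m → ℤ_[p]} {D : Fin m → Fin d → ℤ_[p]}

theorem norm_mul_errorForm_append_le {j : Fin m} {t : ℝ}
    (htan : ‖tangentForm (Fin.append x v) q D (Fin.natAdd d j) b‖ ≤ t)
    (herr : ∀ i, ‖errorForm (Fin.append x' v') (Fin.castAdd m i) b‖ ≤ t)
    (hder : ‖(b 0 : ℤ_[p])‖ * ‖q j * (v' j - v j) - ∑ i, D j i * (x' i - x i)‖ ≤ t) :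
    ‖q j‖ * ‖errorForm (Fin.append x' v') (Fin.natAdd d j) b‖ ≤ t := by
  have hshift : tangentForm (Fin.append x' v') q D (Fin.natAdd d j) b =
      tangentForm (Fin.append x v) q D (Fin.natAdd d j) b +
        b 0 * (q j * (v' j - v j) - ∑ i, D j i * (x' i - x i)) := by
    have hsum : ∑ i, D j i * (b 0 * x' i - b (Fin.castAdd m i).succ) =
        ∑ i, D j i * (b 0 * x i - b (Fin.castAdd m i).succ) +
          b 0 * ∑ i, D j i * (x' i - x i) := by
      rw [Finset.mul_sum, ← Finset.sum_add_distrib]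
      exact Finset.sum_congr rfl fun i _ => by ring
    simp only [tangentForm_natAdd_apply, errorForm_apply, Fin.append_left, Fin.append_right, hsum]
    ring
  refine norm_mul_errorForm_natAdd_le (D := D) ?_ herr
  rw [hshift]
  exact (PadicInt.nonarchimedean _ _).trans (max_le htan ((norm_mul _ _).trans_le hder))

theorem norm_sub_le_of_norm_sub_center_le {w : Fin d → ℤ_[p]} {r : Fin d → ℝ} {θ R : ℝ}
    (hθ : θ ≤ 1) (hR : 0 ≤ R) (hr : ∀ i, r i ≤ R) (hx : ∀ i, ‖x i - w i‖ ≤ r i)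
    (hx' : ∀ i, ‖x' i - w i‖ ≤ θ * r i) : ‖x' - x‖ ≤ R := by
  refine (pi_norm_le_iff_of_nonneg hR).2 fun i => ?_
  have hri : 0 ≤ r i := (norm_nonneg _).trans (hx i)
  rw [Pi.sub_apply, ← sub_sub_sub_cancel_right _ _ (w i), sub_eq_add_neg]
  refine (PadicInt.nonarchimedean _ _).trans (max_le ?_ ?_)
  · exact (hx' i).trans ((mul_le_of_le_one_left hri hθ).trans (hr i))
  · exact (norm_neg _).trans_le ((hx i).trans (hr i))

variable {τ : Fin (d + m) → ℝ} {w : Fin d → ℤ_[p]} {C η θ ε : ℝ}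

theorem norm_errorForm_castAdd_le (hb0 : (b 0 : ℤ_[p]) ≠ 0) (hθC : θ * C ≤ η)
    (hw : ∀ i : Fin d, (b (Fin.castAdd m i).succ : ℤ_[p]) = b 0 * w i)
    (hx' : ∀ i, ‖x' i - w i‖ ≤ θ * approxRadius p C τ b (Fin.castAdd m i)) (i : Fin d) :
    ‖errorForm (Fin.append x' v') (Fin.castAdd m i) b‖ ≤
      η * ‖b‖ ^ (-τ (Fin.castAdd m i)) := by
  rw [errorForm_eq_head_mul (hw i), Fin.append_left, norm_mul]
  calc ‖(b 0 : ℤ_[p])‖ * ‖x' i - w i‖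
      ≤ ‖(b 0 : ℤ_[p])‖ * (θ * approxRadius p C τ b (Fin.castAdd m i)) := by gcongr; exact hx' i
    _ = θ * C * ‖b‖ ^ (-τ (Fin.castAdd m i)) := by
        rw [mul_left_comm, norm_mul_approxRadius C τ hb0, mul_assoc]
    _ ≤ η * ‖b‖ ^ (-τ (Fin.castAdd m i)) := by gcongr

theorem norm_errorForm_natAdd_le (hb0 : (b 0 : ℤ_[p]) ≠ 0) (hC : 0 < C) (hη : 0 ≤ η)
    (hθ : θ ≤ 1) (hθC : θ * C ≤ η) {j : Fin m}
    (hτ : ∀ i, τ (Fin.natAdd d j) ≤ τ (Fin.castAdd m i))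
    (htan : ‖tangentForm (Fin.append x v) q D (Fin.natAdd d j) b‖ ≤
      η * ‖b‖ ^ (-τ (Fin.natAdd d j)))
    (hw : ∀ i : Fin d, (b (Fin.castAdd m i).succ : ℤ_[p]) = b 0 * w i)
    (hx : ∀ i, ‖x i - w i‖ ≤ approxRadius p C τ b (Fin.castAdd m i))
    (hx' : ∀ i, ‖x' i - w i‖ ≤ θ * approxRadius p C τ b (Fin.castAdd m i))
    (hder : ‖q j * (v' j - v j) - ∑ i, D j i * (x' i - x i)‖ ≤ η / C * ‖x' - x‖) :
    ‖q j‖ * ‖errorForm (Fin.append x' v') (Fin.natAdd d j) b‖ ≤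
      η * ‖b‖ ^ (-τ (Fin.natAdd d j)) := by
  have hb1 : 1 ≤ ‖b‖ := one_le_norm_of_ne_zero (ne_zero_of_cast_ne_zero hb0)
  refine norm_mul_errorForm_append_le htan (fun i =>
    (norm_errorForm_castAdd_le hb0 hθC hw hx' i).trans (by gcongr; exact hτ i)) ?_
  have hsub : ‖x' - x‖ ≤ approxRadius p C τ b (Fin.natAdd d j) :=
    norm_sub_le_of_norm_sub_center_le hθ (approxRadius_pos hC τ hb0 _).le
      (fun i => by unfold approxRadius; gcongr; exact hτ i) hx hx'
  calc ‖(b 0 : ℤ_[p])‖ * ‖q j * (v' j - v j) - ∑ i, D j i * (x' i - x i)‖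
      ≤ ‖(b 0 : ℤ_[p])‖ * (η / C * approxRadius p C τ b (Fin.natAdd d j)) := by
        gcongr
        exact hder.trans (by gcongr)
    _ = η * ‖b‖ ^ (-τ (Fin.natAdd d j)) := by
        rw [mul_left_comm, norm_mul_approxRadius C τ hb0, ← mul_assoc, div_mul_cancel₀ _ hC.ne']

theorem eventually_exists_center {f : (Fin d → ℤ_[p]) → Fin m → ℤ_[p]} {α : ℝ}
    (hder : ∀ j, (fun x' => q j * (f x' j - f x j) - ∑ i, D j i * (x' i - x i)) =o[𝓝 x]
      fun x' => x' - x)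
    (hq : ∀ j, η < ε * ‖q j‖) (hC : 0 < C) (hη : 0 < η) (hηε : η < ε) (hθ : θ ≤ 1)
    (hθC : θ * C ≤ η) (hα : ∀ i, α < τ i)
    (hτ : ∀ i j, τ (Fin.natAdd d j) ≤ τ (Fin.castAdd m i)) :
    ∀ᶠ b in cofinite, (∀ i, ‖tangentForm (Fin.append x (f x)) q D i b‖ ≤
        Fin.append (fun _ => C) (fun _ => η) i * ‖b‖ ^ (-τ i)) →
      ‖b‖ ^ (-α) < ‖(b 0 : ℤ_[p])‖ →
      ∃ w : Fin d → ℤ_[p], (∀ i, ‖x i - w i‖ ≤ approxRadius p C τ b (Fin.castAdd m i)) ∧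
        ∀ x', (∀ i, ‖x' i - w i‖ ≤ θ * approxRadius p C τ b (Fin.castAdd m i)) →
          ∀ i, ‖errorForm (Fin.append x' (f x')) i b‖ < ε * ‖b‖ ^ (-τ i) := by
  obtain ⟨δ, hδ, hball⟩ := Metric.nhds_basis_closedBall.eventually_iff.1
    (eventually_all.2 fun j => (hder j).bound (div_pos hη hC))
  filter_upwards [eventually_approxRadius_le (p := p) hα C (lt_min hδ one_pos)]
    with b hrad htan hhead
  have hr := hrad hhead
  have hb0 : (b 0 : ℤ_[p]) ≠ 0 :=
    norm_pos_iff.1 ((Real.rpow_nonneg (norm_nonneg b) _).trans_lt hhead)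
  have hbpos : 0 < ‖b‖ := norm_pos_iff.2 (ne_zero_of_cast_ne_zero hb0)
  choose w hw hxw using fun i : Fin d => exists_center hb0 ((hr _).trans (min_le_right _ _))
    (by simpa only [tangentForm_castAdd, Fin.append_left] using htan (Fin.castAdd m i))
  simp only [Fin.append_left] at hxw
  refine ⟨w, hxw, fun x' hx' i => ?_⟩
  induction i using Fin.addCases with
  | left i =>
    exact (norm_errorForm_castAdd_le hb0 hθC hw hx' i).trans_lt (by gcongr)
  | right j =>
    have hx'x : ‖x' - x‖ ≤ δ := norm_sub_le_of_norm_sub_center_le hθ hδ.le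
      (fun i => (hr _).trans (min_le_left _ _)) hxw hx'
    have hle := norm_errorForm_natAdd_le hb0 hC hη.le hθ hθC (fun i => hτ i j)
      (by simpa only [Fin.append_right] using htan (Fin.natAdd d j)) hw hxw hx'
      (hball (mem_closedBall_iff_norm.2 hx'x) j)
    have hqpos : 0 < ‖q j‖ := pos_of_mul_pos_right (hη.trans (hq j)) (hη.trans hηε).le
    refine lt_of_mul_lt_mul_left (hle.trans_lt ?_) hqpos.le
    calc η * ‖b‖ ^ (-τ (Fin.natAdd d j)) < ε * ‖q j‖ * ‖b‖ ^ (-τ (Fin.natAdd d j)) := by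
          gcongr
          exact hq j
      _ = ‖q j‖ * (ε * ‖b‖ ^ (-τ (Fin.natAdd d j))) := by ring

end Graph

/-! ### Badly approximable points -/

section UniformlyBad

variable {S : Finset Nat.Primes} {n : ℕ} {τ : Fin n → S → ℝ} {y : ZS S n} {ε T : ℝ}

/-- The points that have no rational approximation of quality `ε` and height at least `T`. -/
def uniformlyBad (τ : Fin n → S → ℝ) (ε T : ℝ) : Set (ZS S n) :=
  {y | ∀ b, T ≤ ‖b‖ → ∃ i ν, ε * ‖b‖ ^ (-τ i ν) ≤ ‖errorForm (y ν) i b‖}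

theorem bad_subset_iUnion_uniformlyBad (τ : Fin n → S → ℝ) :
    Bad τ ⊆ ⋃ (ℓ : ℕ+) (T : ℕ), uniformlyBad τ (1 / (ℓ : ℝ)) T := by
  intro y hy
  rw [Bad, mem_compl_iff, mem_iInter, not_forall] at hy
  obtain ⟨ℓ, hℓ⟩ := hy
  obtain ⟨R, hR⟩ := exists_forall_of_eventually_cofinite
    (eventually_cofinite.2 ((not_infinite.1 hℓ).subset fun _ => not_not.1))
  obtain ⟨T, hT⟩ := exists_nat_gt R
  refine mem_iUnion₂.2 ⟨ℓ, T, fun b hb => ?_⟩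
  by_contra! hsmall
  exact hR b (hT.trans_le hb) hsmall

theorem notMem_uniformlyBad_of_errorForm_eq_zero {b : Fin (n + 1) → ℤ} (hb : b ≠ 0)
    (h : ∀ ν i, errorForm (y ν) i b = 0) (hε : 0 < ε) : y ∉ uniformlyBad τ ε T := by
  intro hy
  obtain ⟨N, hN⟩ := exists_nat_gt (max T 0)
  have hN0 : (0 : ℝ) < N := (le_max_right T 0).trans_lt hN
  have hnorm : ‖N • b‖ = N * ‖b‖ := by
    rw [← Nat.cast_smul_eq_nsmul ℤ, norm_smul, Int.norm_natCast]
  have hpos : 0 < ‖N • b‖ := hnorm ▸ mul_pos hN0 (norm_pos_iff.2 hb)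
  have hT : T ≤ ‖N • b‖ := by
    rw [hnorm]
    exact ((le_max_left T 0).trans hN.le).trans
      (le_mul_of_one_le_right hN0.le (one_le_norm_of_ne_zero hb))
  obtain ⟨i, ν, hle⟩ := hy _ hT
  rw [map_nsmul, h, smul_zero, norm_zero] at hle
  exact hle.not_gt (by positivity)

theorem exists_lt_and_hasLargeEntries {ν : S}
    (h : (∃ i, τ i ν ≤ 1) → ∃ α, 0 < α ∧ (∀ i σ, α < τ i σ) ∧
      pointExponent (modWeights τ ν α) y < ((1 + α / ((1 - α) * (n + 1)) : ℝ) : EReal)) :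
    ∃ α, 0 < α ∧ (∀ i, α < τ i ν) ∧ ((∀ i, 1 < τ i ν) ∨ HasLargeEntries τ y ν α) := by
  by_cases hlarge : ∀ i, 1 < τ i ν
  · exact ⟨1, one_pos, hlarge, .inl hlarge⟩
  · push Not at hlarge
    obtain ⟨α, hα0, hα, hexp⟩ := h hlarge
    obtain ⟨i, hi⟩ := hlarge
    exact ⟨α, hα0, fun i => hα i ν,
      .inr (hasLargeEntries_of_pointExponent_lt hα0 ((hα i ν).trans_le hi) hα hexp)⟩

end UniformlyBad

section Graph

variable {S : Finset Nat.Primes} {d m : ℕ}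
  {f : (ν : S) → (Fin d → ℤ_[((ν : Nat.Primes) : ℕ)]) → Fin m → ℤ_[((ν : Nat.Primes) : ℕ)]}
  {τ : Fin (d + m) → S → ℝ} {x : ZS S d} {ε : ℝ}

theorem exists_errorForm_eq_zero_or_exists_boxS_disjoint (hd : 0 < d)
    (hf : ∀ ν j, IsDifferentiableAt (fun z => f ν z j) (x ν))
    (hτsum : ∑ i, ∑ ν, τ i ν = ((d + m : ℕ) : ℝ) + 1)
    (hτdom : ∀ ν (i : Fin d) (j : Fin m), τ (Fin.natAdd d j) ν ≤ τ (Fin.castAdd m i) ν)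
    (hden : ∀ ν, ∃ α, 0 < α ∧ (∀ i, α < τ i ν) ∧
      ((∀ i, 1 < τ i ν) ∨ HasLargeEntries τ (graphMap f x) ν α)) (hε : 0 < ε) :
    (∃ b ≠ 0, ∀ ν i, errorForm (graphMap f x ν) i b = 0) ∨
    ∃ θ : ℝ, 0 < θ ∧ θ ≤ 1 ∧ ∀ T δ : ℝ, 0 < δ → ∃ (w : ZS S d) (r : S → Fin d → ℝ),
      (∀ ν i, 0 < r ν i ∧ r ν i ≤ δ) ∧ x ∈ boxS w r ∧
        ∀ x' ∈ boxS w fun ν i => θ * r ν i, graphMap f x' ∉ uniformlyBad τ ε T := by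
  choose q hq D hD using fun ν j => (hf ν j).exists_integral_derivative
  choose α hα0 hα hden using hden
  obtain ⟨η, hη, hηε, hηq⟩ : ∃ η > 0, η < ε ∧ ∀ ν j, η < ε * ‖q ν j‖ := by
    have hev : ∀ᶠ η in 𝓝[>] (0 : ℝ), 0 < η ∧ η < ε ∧ ∀ ν j, η < ε * ‖q ν j‖ :=
      eventually_mem_nhdsWithin.and <| eventually_nhdsWithin_of_eventually_nhds <|
        (eventually_lt_nhds hε).and <| eventually_all.2 fun ν => eventually_all.2 fun j =>
          eventually_lt_nhds (mul_pos hε (norm_pos_iff.2 (hq ν j)))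
    exact hev.exists
  refine (exists_errorForm_eq_zero_or_frequently (D := D) hd hτsum hτdom hq hα0
    (fun i ν => hα ν i) hden hη).imp_right ?_
  rintro ⟨C, hC, hfreq⟩
  refine ⟨min 1 (η / C), by positivity, min_le_left _ _, fun T δ hδ => ?_⟩
  have hcenter := eventually_all.2 fun ν => eventually_exists_center (hD ν) (hηq ν) hC hη hηε
    (min_le_left 1 (η / C)) ((le_div_iff₀ hC).1 (min_le_right 1 (η / C))) (hα ν) (hτdom ν)
  have hradius := eventually_all.2 fun ν : S =>
    eventually_approxRadius_le (p := ((ν : Nat.Primes) : ℕ)) (hα ν) C hδ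
  obtain ⟨b, ⟨htan, hhead⟩, hcenter, hradius, hT⟩ := (hfreq.and_eventually (hcenter.and
    (hradius.and (tendsto_norm_cofinite.eventually_ge_atTop T)))).exists
  choose w hxw hw using fun ν => hcenter ν (htan ν) (hhead ν)
  refine ⟨w, fun ν i => approxRadius ((ν : Nat.Primes) : ℕ) C (fun i => τ i ν) b
    (Fin.castAdd m i), fun ν i => ⟨?_, hradius ν (hhead ν) _⟩, mem_boxS.2 hxw, ?_⟩
  · exact approxRadius_pos hC _ (norm_pos_iff.1
      ((Real.rpow_nonneg (norm_nonneg b) _).trans_lt (hhead ν))) _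
  · intro x' hx' hbad
    obtain ⟨i, ν, hle⟩ := hbad b hT
    exact hle.not_gt (hw ν (x' ν) (mem_boxS.1 hx' ν) i)

theorem haarS_inter_preimage_uniformlyBad {U : Set (ZS S d)} (hd : 0 < d)
    (hf : ∀ x ∈ U, ∀ ν j, IsDifferentiableAt (fun z => f ν z j) (x ν))
    (hτsum : ∑ i, ∑ ν, τ i ν = ((d + m : ℕ) : ℝ) + 1)
    (hτdom : ∀ ν (i : Fin d) (j : Fin m), τ (Fin.natAdd d j) ν ≤ τ (Fin.castAdd m i) ν)
    (hden : ∀ᵐ x ∂haarS S d, x ∈ U → ∀ ν, ∃ α, 0 < α ∧ (∀ i, α < τ i ν) ∧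
      ((∀ i, 1 < τ i ν) ∨ HasLargeEntries τ (graphMap f x) ν α)) (hε : 0 < ε) (T : ℝ) :
    haarS S d (U ∩ graphMap f ⁻¹' uniformlyBad τ ε T) = 0 := by
  rw [measure_eq_zero_iff_ae_notMem]
  filter_upwards [hden, ae_inter_boxS_nonempty (U ∩ graphMap f ⁻¹' uniformlyBad τ ε T)]
    with x hx hdens hxE
  rcases exists_errorForm_eq_zero_or_exists_boxS_disjoint hd (hf x hxE.1) hτsum hτdom
    (hx hxE.1) hε with ⟨b, hb, hzero⟩ | ⟨θ, hθ0, hθ1, hbox⟩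
  · exact notMem_uniformlyBad_of_errorForm_eq_zero hb hzero hε hxE.2
  · obtain ⟨δ, hδ, hmeet⟩ := hdens hxE (fun _ => θ) fun _ => ⟨hθ0, hθ1⟩
    obtain ⟨w, r, hr, hxw, hgood⟩ := hbox T δ hδ
    obtain ⟨x', hx'E, hx'⟩ := hmeet w r hr hxw
    exact hgood x' hx' hx'E.2

theorem ae_exists_pointExponent_lt {U : Set (ZS S d)} {F : ZS S d → ZS S (d + m)} {ω : ℝ → EReal}
    (h : ∀ ν : S, (∃ i, τ i ν ≤ 1) → ∃ α : ℝ, 0 < α ∧ (∀ i σ, α < τ i σ) ∧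
      manifoldExponent (modWeights τ ν α) U F < ω α) :
    ∀ᵐ x ∂haarS S d, x ∈ U → ∀ ν : S, (∃ i, τ i ν ≤ 1) → ∃ α : ℝ, 0 < α ∧ (∀ i σ, α < τ i σ) ∧
      pointExponent (modWeights τ ν α) (F x) < ω α := by
  have hplace : ∀ ν : S, ∀ᵐ x ∂haarS S d, x ∈ U → (∃ i, τ i ν ≤ 1) → ∃ α : ℝ, 0 < α ∧
      (∀ i σ, α < τ i σ) ∧ pointExponent (modWeights τ ν α) (F x) < ω α := fun ν => by
    by_cases hν : ∃ i, τ i ν ≤ 1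
    · obtain ⟨α, hα0, hα, hlt⟩ := h ν hν
      obtain ⟨ω', hω', hω'lt⟩ := sInf_lt_iff.1 hlt
      filter_upwards [hω'] with x hx hxU _ using ⟨α, hα0, hα, (hx hxU).trans_lt hω'lt⟩
    · exact .of_forall fun _ _ hν' => absurd hν' hν
  filter_upwards [ae_all_iff.2 hplace] with x hx hxU ν using hx ν hxU

end Graph

end SArith

end

theorem theorem8p8_general {S : Finset Nat.Primes} {d m : ℕ} (hd : 0 < d)
    {U : Set (SArith.ZS S d)}
    {f : (ν : S) → (Fin d → ℤ_[((ν : Nat.Primes) : ℕ)]) →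
      Fin m → ℤ_[((ν : Nat.Primes) : ℕ)]}
    (hf : ∀ x ∈ U, ∀ ν j, SArith.IsDifferentiableAt (fun z => f ν z j) (x ν))
    {τ : Fin (d + m) → S → ℝ}
    (hτsum : ∑ i, ∑ ν, τ i ν = ((d + m : ℕ) : ℝ) + 1)
    (hτdom : ∀ ν (i : Fin d) (j : Fin m), τ (Fin.natAdd d j) ν ≤ τ (Fin.castAdd m i) ν)
    (hexp : ∀ᵐ x ∂SArith.haarS S d, x ∈ U → ∀ ν : S, (∃ i, τ i ν ≤ 1) →
      ∃ α : ℝ, 0 < α ∧ (∀ i σ, α < τ i σ) ∧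
        SArith.pointExponent (SArith.modWeights τ ν α) (SArith.graphMap f x)
          < ((1 + α / ((1 - α) * (((d + m : ℕ) : ℝ) + 1)) : ℝ) : EReal)) :
    SArith.haarS S d (U ∩ SArith.graphMap f ⁻¹' SArith.Bad τ) = 0 := by
  have hden := hexp.mono fun x hx hxU ν => SArith.exists_lt_and_hasLargeEntries (hx hxU ν)
  refine measure_mono_null (Set.inter_subset_inter_right _
    (Set.preimage_mono (SArith.bad_subset_iUnion_uniformlyBad τ))) ?_
  simp only [Set.preimage_iUnion, Set.inter_iUnion]
  exact measure_iUnion_null fun ℓ => measure_iUnion_null fun T =>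
    SArith.haarS_inter_preimage_uniformlyBad hd hf hτsum hτdom hden (by positivity) T

theorem theorem8p8 (S : Finset Nat.Primes) (d m : ℕ) (hd : 0 < d)
    (U : (ν : S) → Set (Fin d → ℤ_[((ν : Nat.Primes) : ℕ)]))
    (hU : ∀ ν, IsOpen (U ν))
    (f : (ν : S) → (Fin d → ℤ_[((ν : Nat.Primes) : ℕ)]) →
      Fin m → ℤ_[((ν : Nat.Primes) : ℕ)])
    (hf : ∀ ν j, SArith.IsC2On (fun x => f ν x j) (U ν))
    (τ : Fin (d + m) → S → ℝ)
    (hτpos : ∀ i ν, 0 < τ i ν)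
    (hτsum : ∑ i, ∑ ν, τ i ν = ((d + m : ℕ) : ℝ) + 1)
    (hτdom : ∀ ν (i : Fin d) (j : Fin m), τ (Fin.natAdd d j) ν ≤ τ (Fin.castAdd m i) ν)
    (hτone : ∀ i, 1 < ∑ ν, τ i ν)
    (hexp : ∀ ν : S, (∃ i, τ i ν ≤ 1) →
      ∃ α : ℝ, 0 < α ∧ (∀ i σ, α < τ i σ) ∧
        SArith.manifoldExponent (SArith.modWeights τ ν α) (Set.univ.pi U) (SArith.graphMap f)
          < ((1 + α / ((1 - α) * (((d + m : ℕ) : ℝ) + 1)) : ℝ) : EReal)) :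
    SArith.haarS S d (Set.univ.pi U ∩ SArith.graphMap f ⁻¹' SArith.Bad τ) = 0 :=
  theorem8p8_general (U := Set.univ.pi U) hd
    (fun _ hx ν j => (hf ν j).isDifferentiableAt (hU ν) (hx ν trivial))
    hτsum hτdom (SArith.ae_exists_pointExponent_lt hexp)
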